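/- Let $\tau_1,\tau_2>0$ with $\min(\tau_1,\tau_2)=1$, let $0<a<1/2$, $\varepsilon>0$ and $\theta\in\mathbb R$, and put $\hat{\boldsymbol q}=(\cos\theta,\sin\theta)$. Let $\epsilon(\boldsymbol r)=\varepsilon$ in the disks of radius $a$ centred at the nodes $(m\tau_1,n\tau_2)$, $m,n\in\mathbb Z$, and $\epsilon(\boldsymbol r)=1$ elsewhere in $\mathbb R^2$; let $\mathcal S=(-\tau_1/2,\tau_1/2)\times(-\tau_2/2,\tau_2/2)$. For small $q>0$ let $u(\cdot,q)\in H^1_{\rm loc}(\mathbb R^2)$ be a Bloch eigenfunction with quasimomentum $q\hat{\boldsymbol q}$ and eigenvalue $\nu^2=\nu^2(q)$, that is, a nonzero weak solution in $\mathbb R^2$ of $$-\nabla\cdot(\epsilon^{-1}\nabla u)=\nu^2u,\qquad u(\boldsymbol r+\boldsymbol\tau)=e^{iq\hat{\boldsymbol q}\cdot\boldsymbol\tau}u(\boldsymbol r)\quad\text{for all lattice periods }\boldsymbol\tau=(m\tau_1,n\tau_2)$$ (so that $u$ and $\epsilon^{-1}\partial u/\partial n$ are continuous across the circles), normalized by $\int_{\mathcal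 S}u\,dS=\tau_1\tau_2$. Let $$u=1+\sum_{k\ge1}q^ku_k,\qquad \nu^2=\sum_{k\ge1}q^k\lambda_k$$ be its expansion for small $q>0$, with $u_k\in H^1(\mathcal S)$ and $\lambda_k$ independent of $q$, the first series converging in $H^1(\mathcal S)$. Then, as elements of $H^1(\mathcal S)$ (that is, for almost every $\boldsymbol r\in\mathcal S$), $u_k(-\boldsymbol r)=-u_k(\boldsymbol r)$ for odd $k$ and $u_k(-\boldsymbol r)=u_k(\boldsymbol r)$ for even $k$. The expansion of $\nu^2$ contains only even powers of $q$: $\lambda_{2k-1}=0$ for $k=1,2,\dots$ -/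

import Mathlib

open MeasureTheory Set
open scoped ContDiff

noncomputable section

/-- The `xy`-plane; `volume` is Lebesgue measure. The sup norm of the product type is never used
for distances below: disks are given by their Euclidean equations. -/
abbrev Plane : Type := ℝ × ℝ

/-- Complex-valued smooth functions with compact support contained in `Ω`. -/
structure IsTestFunction (Ω : Set Plane) (φ : Plane → ℂ) : Prop where
  smooth : ContDiff ℝ ∞ φ
  compact_support : HasCompactSupport φ
  support_subset : tsupport φ ⊆ Ω

/-- The direction of the `x`-axis. -/
def dirX : Plane := (1, 0)

/-- The direction of the `y`-axis. -/
def dirY : Plane := (0, 1)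

/-- `g` is the weak derivative of `u` in the direction `e` in the open set `Ω`. It is only applied
to functions that are (locally) square integrable, so that all the integrals converge. -/
def HasWeakPartial (Ω : Set Plane) (e : Plane) (u g : Plane → ℂ) : Prop :=
  ∀ φ : Plane → ℂ, IsTestFunction Ω φ →
    ∫ r in Ω, u r * fderiv ℝ φ r e = -∫ r in Ω, g r * φ r

/-- Local square integrability on the plane. -/
def LocallyL2 (u : Plane → ℂ) : Prop :=
  ∀ K : Set Plane, IsCompact K → MemLp u 2 (volume.restrict K)

/-- The triples of elements of `L²(Ω)`, with the Hilbert norm. -/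
abbrev L2Triple (Ω : Set Plane) : Type :=
  PiLp 2 (fun _ : Fin 3 => Lp ℂ 2 (volume.restrict Ω))

theorem IsTestFunction.memLp {Ω : Set Plane} {φ : Plane → ℂ} (h : IsTestFunction Ω φ) :
    MemLp φ 2 (volume.restrict Ω) :=
  (h.smooth.continuous.memLp_of_hasCompactSupport h.compact_support).restrict Ω

theorem IsTestFunction.memLp_fderiv {Ω : Set Plane} {φ : Plane → ℂ} (h : IsTestFunction Ω φ)
    (e : Plane) : MemLp (fun r => fderiv ℝ φ r e) 2 (volume.restrict Ω) := by
  have hc : Continuous (fun r => fderiv ℝ φ r e) :=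
    (h.smooth.continuous_fderiv (by simp)).clm_apply continuous_const
  exact (hc.memLp_of_hasCompactSupport (h.compact_support.fderiv_apply ℝ e)).restrict Ω

theorem hasWeakPartial_zero (Ω : Set Plane) (e : Plane) :
    HasWeakPartial Ω e ((0 : Lp ℂ 2 (volume.restrict Ω)) : Plane → ℂ)
      ((0 : Lp ℂ 2 (volume.restrict Ω)) : Plane → ℂ) := by
  intro φ _
  have h0 := Lp.coeFn_zero ℂ 2 (volume.restrict Ω)
  have hz : ∀ ψ : Plane → ℂ,
      ∫ r in Ω, ((0 : Lp ℂ 2 (volume.restrict Ω)) : Plane → ℂ) r * ψ r = 0 := by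
    intro ψ
    rw [integral_eq_zero_of_ae]
    filter_upwards [h0] with r hr
    rw [hr, Pi.zero_apply]
    exact zero_mul _
  rw [hz, hz, neg_zero]

theorem hasWeakPartial_add {Ω : Set Plane} {e : Plane} {u g u' g' : Lp ℂ 2 (volume.restrict Ω)}
    (h : HasWeakPartial Ω e u g) (h' : HasWeakPartial Ω e u' g') :
    HasWeakPartial Ω e (u + u' : Lp ℂ 2 (volume.restrict Ω))
      (g + g' : Lp ℂ 2 (volume.restrict Ω)) := by
  intro φ hφ
  have key : ∀ (v w : Lp ℂ 2 (volume.restrict Ω)) (ψ : Plane → ℂ),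
      MemLp ψ 2 (volume.restrict Ω) →
      ∫ r in Ω, ((v + w : Lp ℂ 2 (volume.restrict Ω)) : Plane → ℂ) r * ψ r
        = (∫ r in Ω, v r * ψ r) + ∫ r in Ω, w r * ψ r := by
    intro v w ψ hψ
    refine Eq.trans (integral_congr_ae ?_)
      (integral_add ((Lp.memLp v).integrable_mul hψ) ((Lp.memLp w).integrable_mul hψ))
    filter_upwards [Lp.coeFn_add v w] with r hr
    rw [hr, Pi.add_apply, add_mul]
  rw [key _ _ _ (hφ.memLp_fderiv e), key _ _ _ hφ.memLp, h φ hφ, h' φ hφ]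
  ring

theorem hasWeakPartial_smul {Ω : Set Plane} {e : Plane} {u g : Lp ℂ 2 (volume.restrict Ω)}
    (c : ℂ) (h : HasWeakPartial Ω e u g) :
    HasWeakPartial Ω e (c • u : Lp ℂ 2 (volume.restrict Ω))
      (c • g : Lp ℂ 2 (volume.restrict Ω)) := by
  intro φ hφ
  have key : ∀ (v : Lp ℂ 2 (volume.restrict Ω)) (ψ : Plane → ℂ),
      ∫ r in Ω, ((c • v : Lp ℂ 2 (volume.restrict Ω)) : Plane → ℂ) r * ψ r
        = c * ∫ r in Ω, v r * ψ r := by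
    intro v ψ
    rw [← integral_const_mul]
    refine integral_congr_ae ?_
    filter_upwards [Lp.coeFn_smul c v] with r hr
    rw [hr, Pi.smul_apply, smul_eq_mul, mul_assoc]
  rw [key, key, h φ hφ, mul_neg]

/-- The Sobolev space `H¹(Ω)` of an open set `Ω`: a function is stored together with its weak
gradient, as the triple `(u, ∂u/∂x, ∂u/∂y)` in `L²(Ω)³`, so that the inherited norm is
`(‖u‖² + ‖∂u/∂x‖² + ‖∂u/∂y‖²)^{1/2}`. The gradient is determined by `u`. -/
def H1 (Ω : Set Plane) : Submodule ℂ (L2Triple Ω) where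
  carrier := {w | HasWeakPartial Ω dirX (w 0) (w 1) ∧ HasWeakPartial Ω dirY (w 0) (w 2)}
  zero_mem' := ⟨hasWeakPartial_zero Ω dirX, hasWeakPartial_zero Ω dirY⟩
  add_mem' := fun h h' => ⟨hasWeakPartial_add h.1 h'.1, hasWeakPartial_add h.2 h'.2⟩
  smul_mem' := fun c _ h => ⟨hasWeakPartial_smul c h.1, hasWeakPartial_smul c h.2⟩

/-- The function (up to null sets) that underlies an element of `H¹(Ω)`. -/
def H1.fn {Ω : Set Plane} (w : H1 Ω) : Plane → ℂ := ((w : L2Triple Ω) 0 : Plane → ℂ)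

/-- The node `m τ₁ + n τ₂` of the rectangular lattice with side lengths `τ₁`, `τ₂`. -/
def latticeNode (τ₁ τ₂ : ℝ) (m n : ℤ) : Plane := (m * τ₁, n * τ₂)

/-- The fundamental cell, a rectangle centred at the origin. -/
def cell (τ₁ τ₂ : ℝ) : Set Plane := Ioo (-(τ₁ / 2)) (τ₁ / 2) ×ˢ Ioo (-(τ₂ / 2)) (τ₂ / 2)

/-- The array of disks of radius `a` centred at the lattice nodes. -/
def inclusions (τ₁ τ₂ a : ℝ) : Set Plane :=
  {r | ∃ m n : ℤ, (r.1 - m * τ₁) ^ 2 + (r.2 - n * τ₂) ^ 2 < a ^ 2}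

open Classical in
/-- The dielectric function: `ε` in the disks and `1` in the matrix. -/
def permittivity (τ₁ τ₂ a ε : ℝ) (r : Plane) : ℝ := if r ∈ inclusions τ₁ τ₂ a then ε else 1

/-- `u` is a Bloch eigenfunction with wave vector `k` and eigenvalue `lam` (`= ν²`) of the operator
`-∇ · (ϵ⁻¹ ∇)` in the plane. The equation holds in the weak sense across the interfaces: for
`u` in `H¹_loc` this contains the continuity of `u` and of `ϵ⁻¹ ∂u/∂n`. -/
structure IsBlochEigenfunction (τ₁ τ₂ a ε : ℝ) (k : Plane) (u : Plane → ℂ) (lam : ℂ) : Prop where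
  weak_solution : ∃ gx gy : Plane → ℂ,
    LocallyL2 u ∧ LocallyL2 gx ∧ LocallyL2 gy ∧
    HasWeakPartial univ dirX u gx ∧ HasWeakPartial univ dirY u gy ∧
    ∀ φ : Plane → ℂ, IsTestFunction univ φ →
      ∫ r, ((permittivity τ₁ τ₂ a ε r)⁻¹ : ℂ) *
          (gx r * fderiv ℝ φ r dirX + gy r * fderiv ℝ φ r dirY) = lam * ∫ r, u r * φ r
  quasiperiodic : ∀ m n : ℤ, ∀ᵐ r : Plane,
    u (r + latticeNode τ₁ τ₂ m n) =
      Complex.exp (Complex.I * ((k.1 * (m * τ₁) + k.2 * (n * τ₂) : ℝ) : ℂ)) * u r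
  nontrivial : ¬ u =ᵐ[volume] 0

/-- The expansion `u = 1 + q u₁ + q² u₂ + ⋯`, `ν² = q λ₁ + q² λ₂ + ⋯`, valid for `0 < q < q₀`,
of a family of Bloch eigenfunctions `u q` with wave vectors `q (cos θ, sin θ)` and eigenvalues
`nuSq q`, normalized to have mean value one over the cell. The first series converges in `H¹` of
the cell; `uCoeff k` is `u_k` and `lamCoeff k` is `λ_k`. -/
structure IsBlochExpansion (τ₁ τ₂ a ε θ q₀ : ℝ) (u : ℝ → Plane → ℂ) (nuSq : ℝ → ℂ)
    (uCoeff : ℕ → H1 (cell τ₁ τ₂)) (lamCoeff : ℕ → ℂ) : Prop where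
  pos : 0 < q₀
  eigenfunction : ∀ q ∈ Ioo 0 q₀,
    IsBlochEigenfunction τ₁ τ₂ a ε (q * Real.cos θ, q * Real.sin θ) (u q) (nuSq q)
  normalized : ∀ q ∈ Ioo 0 q₀, ∫ r in cell τ₁ τ₂, u q r = ((τ₁ * τ₂ : ℝ) : ℂ)
  uCoeff_zero : H1.fn (uCoeff 0) =ᵐ[volume.restrict (cell τ₁ τ₂)] fun _ => 1
  u_series : ∀ q ∈ Ioo 0 q₀, ∃ w : H1 (cell τ₁ τ₂),
    H1.fn w =ᵐ[volume.restrict (cell τ₁ τ₂)] u q ∧ HasSum (fun k : ℕ => (q : ℂ) ^ k • uCoeff k) w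
  lamCoeff_zero : lamCoeff 0 = 0
  nuSq_series : ∀ q ∈ Ioo 0 q₀, HasSum (fun k : ℕ => (q : ℂ) ^ k * lamCoeff k) (nuSq q)

end

/-! The medium is invariant under `r ↦ -r`, and reflecting a Bloch function reverses its
quasimomentum. Formally, `u(-r, -q)` therefore has the same expansion as `u(r, q)`, which is the
claimed parity. Since the expansion is only given for `q > 0`, the symmetry is applied to the
coefficients instead of the functions.

The `u_k` are not periodic, but `exp(-i q κ·r) u` is. Testing the Bloch equation with `exp(i (ξ -
qκ)·r)`, `ξ` in the reciprocal lattice, gives identities between integrals over one cell, without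
boundary terms (`IsBlochEigenfunction.cell_equations`). They encode the differential equation, the
relation between `u` and its gradient, and quasiperiodicity. Expanding the exponential as well and
comparing powers of `q` gives a recursive hierarchy for `u_k`, its gradient and `λ_k`
(`IsBlochExpansion.isCellHierarchy`).

The hierarchy is preserved when order `k` is reflected and multiplied by `(-1) ^ k`, with one more
sign for gradients (`IsCellHierarchy.reflect`). It also has at most one solution with prescribed
means, `u_0 = 1` and `λ_0 = 0` (`IsCellHierarchy.unique`). Indeed, if two solutions agree below
order `N`, the zero frequency gives equality of the `λ_N`, and the difference of the `u_N` then
solves the homogeneous periodic problem `∇ · (ρ ∇ d) = 0` with mean zero. Parseval's identity turns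
this into `∫ ρ |∇ d|² = 0`, so `d = 0` (`cell_problem_unique`).

The normalization makes the means vanish for `k ≥ 1`, so they too respect the reflection. Hence the
reflected coefficients equal the original ones; in particular `λ_k = (-1) ^ k λ_k`. -/

noncomputable section

/-! ### Power series in a real parameter -/

/-- Convergence on an interval makes a power series absolutely convergent in it. -/
theorem summable_norm_pow_smul {X : Type*} [NormedAddCommGroup X] [NormedSpace ℂ X]
    {q₀ : ℝ} {f : ℕ → X} (hf : ∀ q ∈ Ioo 0 q₀, Summable fun k : ℕ => (q : ℂ) ^ k • f k)
    {q : ℝ} (hq : q ∈ Ioo 0 q₀) : Summable fun k : ℕ => ‖(q : ℂ) ^ k • f k‖ := by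
  obtain ⟨p, hqp, hp⟩ := exists_between hq.2
  have hp0 : 0 < p := hq.1.trans hqp
  obtain ⟨C, hC⟩ := (hf p ⟨hp0, hp⟩).tendsto_atTop_zero.norm.bddAbove_range
  have hr : q / p < 1 := (div_lt_one hp0).2 hqp
  refine Summable.of_nonneg_of_le (fun _ => norm_nonneg _) (fun k => ?_)
    ((summable_geometric_of_lt_one (div_pos hq.1 hp0).le hr).mul_right C)
  have h1 : ‖(p : ℂ) ^ k • f k‖ ≤ C := hC ⟨k, rfl⟩
  have h2 : ‖(q : ℂ) ^ k • f k‖ = (q / p) ^ k * ‖(p : ℂ) ^ k • f k‖ := by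
    rw [norm_smul, norm_smul, norm_pow, norm_pow, Complex.norm_real, Complex.norm_real,
      Real.norm_of_nonneg hq.1.le, Real.norm_of_nonneg hp0.le, ← mul_assoc, ← mul_pow,
      div_mul_cancel₀ _ hp0.ne']
  rw [h2]
  exact mul_le_mul_of_nonneg_left h1 (pow_nonneg (div_pos hq.1 hp0).le _)

/-- A power series that vanishes on an interval `(0, q₀)` has zero coefficients. -/
theorem coeff_eq_zero_of_hasSum_zero {q₀ : ℝ} (hq₀ : 0 < q₀) {c : ℕ → ℂ}
    (hc : ∀ q ∈ Ioo 0 q₀, HasSum (fun k : ℕ => (q : ℂ) ^ k * c k) 0) (N : ℕ) : c N = 0 := by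
  induction N using Nat.strong_induction_on with
  | _ N ih =>
    set p := q₀ / 2 with hp
    have hpm : p ∈ Ioo 0 q₀ := ⟨by positivity, by linarith⟩
    have hsum := summable_norm_pow_smul (X := ℂ) (f := c)
      (fun q hq => by simpa using (hc q hq).summable) hpm
    have hsum' : Summable fun k : ℕ => ‖(p : ℂ) ^ k * c (k + N)‖ := by
      have h1 := ((summable_nat_add_iff N).2 hsum).mul_left ((p ^ N)⁻¹)
      refine h1.congr fun k => ?_
      have : (p : ℝ) ^ N ≠ 0 := pow_ne_zero _ hpm.1.ne'
      rw [smul_eq_mul, norm_mul, norm_mul, norm_pow, norm_pow, Complex.norm_real,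
        Real.norm_of_nonneg hpm.1.le, pow_add]
      field_simp
    have hzero : ∀ q ∈ Ioo 0 q₀, HasSum (fun k : ℕ => (q : ℂ) ^ k * c (k + N)) 0 := by
      intro q hq
      have h1 := (hasSum_nat_add_iff' N).2 (hc q hq)
      rw [Finset.sum_eq_zero (fun i hi => by rw [ih i (Finset.mem_range.1 hi), mul_zero]),
        sub_zero] at h1
      have hqN : (q : ℂ) ^ N ≠ 0 := pow_ne_zero _ (by exact_mod_cast hq.1.ne')
      have h2 := h1.mul_left ((q : ℂ) ^ N)⁻¹
      rw [mul_zero] at h2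
      refine h2.congr_fun fun k => ?_
      rw [pow_add]
      field_simp
    set B := ∑' k : ℕ, ‖(p : ℂ) ^ k * c (k + N)‖ with hB
    -- Once the lower terms are removed and `q ^ N` is divided out, `c N` is minus the tail of the
    -- series. Each tail term is at most `q / p` times its absolute value at `p`, so the tail is
    -- `O(q)` and `q → 0` finishes.
    have hbound : ∀ q ∈ Ioo 0 p, ‖c N‖ ≤ q / p * B := by
      intro q hq
      have h1 := (hasSum_nat_add_iff' 1).2 (hzero q ⟨hq.1, hq.2.trans hpm.2⟩)
      simp only [Finset.range_one, Finset.sum_singleton, pow_zero, one_mul, zero_sub, zero_add] at h1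
      have h2 : ‖-c N‖ ≤ q / p * ∑' k : ℕ, ‖(p : ℂ) ^ (k + 1) * c (k + 1 + N)‖ := by
        refine h1.norm_le_of_bounded
          (((summable_nat_add_iff 1).2 hsum').hasSum.mul_left (q / p)) (fun k => ?_)
        rw [norm_mul, norm_mul, norm_pow, norm_pow, Complex.norm_real, Complex.norm_real,
          Real.norm_of_nonneg hq.1.le, Real.norm_of_nonneg hpm.1.le, ← mul_assoc]
        refine mul_le_mul_of_nonneg_right ?_ (norm_nonneg _)
        have h3 : q ^ k ≤ p ^ k := pow_le_pow_left₀ hq.1.le hq.2.le k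
        have h4 : q / p * p ^ (k + 1) = p ^ k * q := by
          have := hpm.1.ne'
          field_simp
          ring
        rw [h4, pow_succ]
        exact mul_le_mul_of_nonneg_right h3 hq.1.le
      rw [norm_neg] at h2
      refine h2.trans (mul_le_mul_of_nonneg_left ?_ (div_pos hq.1 hpm.1).le)
      rw [hB, hsum'.tsum_eq_zero_add]
      exact le_add_of_nonneg_left (norm_nonneg _)
    have hlim : Filter.Tendsto (fun q : ℝ => q / p * B) (nhdsWithin 0 (Ioi 0)) (nhds 0) := by
      have : Continuous fun q : ℝ => q / p * B := by fun_prop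
      have h := (this.tendsto 0).mono_left (nhdsWithin_le_nhds (s := Ioi 0))
      simpa using h
    have hle : ‖c N‖ ≤ 0 := by
      refine ge_of_tendsto hlim ?_
      filter_upwards [Ioo_mem_nhdsGT hpm.1] with q hq
      exact hbound q hq
    exact norm_le_zero_iff.1 hle

theorem coeff_eq_of_hasSum {q₀ : ℝ} (hq₀ : 0 < q₀) {c d : ℕ → ℂ} {s : ℝ → ℂ}
    (hc : ∀ q ∈ Ioo 0 q₀, HasSum (fun k : ℕ => (q : ℂ) ^ k * c k) (s q))
    (hd : ∀ q ∈ Ioo 0 q₀, HasSum (fun k : ℕ => (q : ℂ) ^ k * d k) (s q)) (N : ℕ) :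
    c N = d N := by
  refine sub_eq_zero.1 (coeff_eq_zero_of_hasSum_zero hq₀ (c := fun k => c k - d k) ?_ N)
  intro q hq
  have := (hc q hq).sub (hd q hq)
  rw [sub_self] at this
  exact this.congr_fun fun k => by ring

/-- The Cauchy product of a power series of functionals with a power series of vectors. -/
theorem hasSum_antidiagonal_apply {X : Type*} [NormedAddCommGroup X] [NormedSpace ℂ X]
    {q : ℂ} {T : ℕ → X →L[ℂ] ℂ} {f : ℕ → X} {T' : X →L[ℂ] ℂ} {F : X}
    (hT : Summable fun j => ‖q ^ j • T j‖) (hf : Summable fun k => ‖q ^ k • f k‖)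
    (hT' : ∀ x, HasSum (fun j => q ^ j * T j x) (T' x)) (hF : HasSum (fun k => q ^ k • f k) F) :
    HasSum (fun N => q ^ N * ∑ p ∈ Finset.HasAntidiagonal.antidiagonal N, T p.1 (f p.2)) (T' F) := by
  have hprod : Summable fun x : ℕ × ℕ => (q ^ x.1 • T x.1) (q ^ x.2 • f x.2) := by
    refine Summable.of_norm_bounded (hT.mul_of_nonneg hf (fun _ => norm_nonneg _)
      (fun _ => norm_nonneg _)) fun x => ?_
    exact ContinuousLinearMap.le_opNorm _ _
  -- The double series converges absolutely, so it may be summed over `j` first, which identifies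
  -- its value, and then along antidiagonals. Pointwise convergence to `T'` suffices.
  have hval : HasSum (fun x : ℕ × ℕ => (q ^ x.1 • T x.1) (q ^ x.2 • f x.2)) (T' F) := by
    have hswap := (Equiv.prodComm ℕ ℕ).summable_iff.2 hprod
    have h1 : HasSum (fun k => T' (q ^ k • f k))
        (∑' x : ℕ × ℕ, ((fun x : ℕ × ℕ => (q ^ x.1 • T x.1) (q ^ x.2 • f x.2)) ∘
          (Equiv.prodComm ℕ ℕ)) x) :=
      hswap.hasSum.prod_fiberwise fun k => by
        simpa [mul_left_comm] using hT' (q ^ k • f k)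
    have h2 := (T'.hasSum hF).unique h1
    rw [h2, show (∑' x : ℕ × ℕ, ((fun x : ℕ × ℕ => (q ^ x.1 • T x.1) (q ^ x.2 • f x.2)) ∘
      (Equiv.prodComm ℕ ℕ)) x) = ∑' x : ℕ × ℕ, (q ^ x.1 • T x.1) (q ^ x.2 • f x.2) from
      (Equiv.prodComm ℕ ℕ).tsum_eq fun x : ℕ × ℕ => (q ^ x.1 • T x.1) (q ^ x.2 • f x.2)]
    exact hprod.hasSum
  have h3 := Finset.HasAntidiagonal.sigmaAntidiagonalEquivProd.hasSum_iff.2 hval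
  have h4 := h3.sigma (g := fun N => q ^ N *
      ∑ p ∈ Finset.HasAntidiagonal.antidiagonal N, T p.1 (f p.2)) fun N => ?_
  · exact h4
  · rw [Finset.mul_sum, ← Finset.sum_coe_sort]
    refine (hasSum_fintype _).congr_fun fun p => ?_
    have h5 : p.1.1 + p.1.2 = N := Finset.HasAntidiagonal.mem_antidiagonal.1 p.2
    change (q ^ p.1.1 • T p.1.1) (q ^ p.1.2 • f p.1.2) = _
    rw [show q ^ N = q ^ p.1.1 * q ^ p.1.2 by rw [← pow_add, h5], map_smul, smul_apply, smul_eq_mul, smul_eq_mul]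
    ring

/-! ### Plane waves and their expansion in `q` -/

/-- The plane wave `exp(i k · r)`. -/
def planeWave (k r : Plane) : ℂ := Complex.exp (Complex.I * ((k.1 * r.1 + k.2 * r.2 : ℝ) : ℂ))

/-- The `j`-th coefficient of `ρ(r) exp(i (ξ - q κ) · r)` as a power series in `q`. -/
def waveCoeff (ρ : Plane → ℝ) (κ ξ : Plane) (j : ℕ) (r : Plane) : ℂ :=
  (ρ r : ℂ) * ((-Complex.I * ((κ.1 * r.1 + κ.2 * r.2 : ℝ) : ℂ)) ^ j / (j.factorial : ℂ)) *
    planeWave ξ r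

theorem norm_planeWave (k r : Plane) : ‖planeWave k r‖ = 1 := by
  rw [planeWave, mul_comm]
  exact Complex.norm_exp_ofReal_mul_I _

theorem continuous_planeWave (k : Plane) : Continuous (planeWave k) := by
  unfold planeWave
  fun_prop

theorem norm_waveCoeff_le {ρ : Plane → ℝ} {P M : ℝ} {κ r : Plane} (hP : |ρ r| ≤ P)
    (hM : |κ.1 * r.1 + κ.2 * r.2| ≤ M) (ξ : Plane) (j : ℕ) :
    ‖waveCoeff ρ κ ξ j r‖ ≤ P * (M ^ j / j.factorial) := by
  rw [waveCoeff, norm_mul, norm_mul, norm_planeWave, mul_one, norm_div, norm_pow, norm_mul,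
    norm_neg, Complex.norm_I, one_mul, Complex.norm_real, Complex.norm_real, Complex.norm_natCast]
  have h0 : 0 ≤ P := (abs_nonneg _).trans hP
  simp only [Real.norm_eq_abs]
  gcongr

theorem measurable_waveCoeff {ρ : Plane → ℝ} (hρ : Measurable ρ) (κ ξ : Plane) (j : ℕ) :
    Measurable (waveCoeff ρ κ ξ j) := by
  have := (continuous_planeWave ξ).measurable
  unfold waveCoeff
  fun_prop

theorem hasSum_waveCoeff (ρ : Plane → ℝ) (κ ξ r : Plane) (q : ℝ) :
    HasSum (fun j : ℕ => (q : ℂ) ^ j * waveCoeff ρ κ ξ j r)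
      ((ρ r : ℂ) * planeWave (ξ - q • κ) r) := by
  have h1 := NormedSpace.expSeries_div_hasSum_exp (𝔸 := ℂ)
    ((q : ℂ) * (-Complex.I * ((κ.1 * r.1 + κ.2 * r.2 : ℝ) : ℂ)))
  have h2 := (h1.mul_left (ρ r : ℂ)).mul_right (planeWave ξ r)
  have h3 : (ρ r : ℂ) * NormedSpace.exp
      ((q : ℂ) * (-Complex.I * ((κ.1 * r.1 + κ.2 * r.2 : ℝ) : ℂ))) * planeWave ξ r =
      (ρ r : ℂ) * planeWave (ξ - q • κ) r := by
    rw [← Complex.exp_eq_exp_ℂ, mul_assoc, planeWave, planeWave, ← Complex.exp_add]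
    congr 2
    simp only [Prod.fst_sub, Prod.snd_sub, Prod.smul_fst, Prod.smul_snd, smul_eq_mul]
    push_cast
    ring
  rw [h3] at h2
  refine h2.congr_fun fun j => ?_
  rw [waveCoeff, mul_pow]
  ring

/-- Integration against a bounded function, as a functional on `L²`. -/
theorem exists_functional {α : Type*} [MeasurableSpace α] {μ : Measure α} [IsFiniteMeasure μ]
    {w : α → ℂ} (hw : AEStronglyMeasurable w μ) {C : ℝ} (hC : 0 ≤ C) (hb : ∀ᵐ r ∂μ, ‖w r‖ ≤ C) :
    ∃ T : Lp ℂ 2 μ →L[ℂ] ℂ, (∀ f : Lp ℂ 2 μ, T f = ∫ r, w r * f r ∂μ) ∧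
      ‖T‖ ≤ (measureUnivNNReal μ : ℝ) ^ ((2 : ENNReal).toReal)⁻¹ * C := by
  -- The conjugate is needed because the inner product is conjugate-linear in its first argument.
  have hm : MemLp (fun r => star (w r)) 2 μ :=
    MemLp.of_bound (continuous_star.comp_aestronglyMeasurable hw) C (by simpa using hb)
  refine ⟨innerSL ℂ hm.toLp, fun f => ?_, ?_⟩
  · rw [innerSL_apply_apply, L2.inner_def]
    refine integral_congr_ae ?_
    filter_upwards [hm.coeFn_toLp] with r hr
    rw [hr]
    simp [mul_comm]
  · rw [innerSL_apply_norm]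
    refine Lp.norm_le_of_ae_bound hC ?_
    filter_upwards [hm.coeFn_toLp, hb] with r hr hbr
    rw [hr]
    simpa using hbr

/-- The power series of the integral of a power series in `L²(Ω)` against a weighted plane wave with
wave vector `ξ - q κ`. -/
theorem hasSum_integral_planeWave {Ω : Set Plane} (hΩ : MeasurableSet Ω)
    [IsFiniteMeasure (volume.restrict Ω)] {ρ : Plane → ℝ} (hρ : Measurable ρ) {P M : ℝ}
    {κ : Plane} (hP : ∀ r, |ρ r| ≤ P) (hM : ∀ r ∈ Ω, |κ.1 * r.1 + κ.2 * r.2| ≤ M) (hM0 : 0 ≤ M)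
    (ξ : Plane) {q : ℝ} {f : ℕ → Lp ℂ 2 (volume.restrict Ω)} {F : Lp ℂ 2 (volume.restrict Ω)}
    (hf : Summable fun k : ℕ => ‖(q : ℂ) ^ k • f k‖)
    (hF : HasSum (fun k : ℕ => (q : ℂ) ^ k • f k) F) :
    HasSum (fun N : ℕ => (q : ℂ) ^ N * ∑ p ∈ Finset.HasAntidiagonal.antidiagonal N,
        ∫ r in Ω, waveCoeff ρ κ ξ p.1 r * f p.2 r)
      (∫ r in Ω, (ρ r : ℂ) * planeWave (ξ - q • κ) r * F r) := by
  have hP0 : 0 ≤ P := (abs_nonneg _).trans (hP 0)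
  have hb : ∀ j : ℕ, ∀ᵐ r ∂(volume.restrict Ω),
      ‖waveCoeff ρ κ ξ j r‖ ≤ P * (M ^ j / j.factorial) := fun j => by
    filter_upwards [ae_restrict_mem hΩ] with r hr
    exact norm_waveCoeff_le (hP r) (hM r hr) ξ j
  choose T hT hTn using fun j => exists_functional
    (measurable_waveCoeff hρ κ ξ j).aestronglyMeasurable (by positivity) (hb j)
  have hEm : Measurable fun r => (ρ r : ℂ) * planeWave (ξ - q • κ) r := by
    have := (continuous_planeWave (ξ - q • κ)).measurable
    fun_prop
  obtain ⟨T', hT', -⟩ := exists_functional (μ := volume.restrict Ω) hEm.aestronglyMeasurable hP0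
    (Filter.Eventually.of_forall fun r => by
      rw [norm_mul, norm_planeWave, mul_one, Complex.norm_real]
      exact hP r)
  have hexp : Summable fun j : ℕ => (|q| * M) ^ j / j.factorial :=
    Real.summable_pow_div_factorial _
  rw [← hT']
  simp only [← hT]
  refine hasSum_antidiagonal_apply ?_ hf (fun x => ?_) hF
  · set A := (measureUnivNNReal (volume.restrict Ω) : ℝ) ^ ((2 : ENNReal).toReal)⁻¹ with hA
    refine Summable.of_nonneg_of_le (fun _ => norm_nonneg _) (fun j => ?_)
      (hexp.mul_left (A * P))
    rw [norm_smul, norm_pow, Complex.norm_real, Real.norm_eq_abs]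
    calc |q| ^ j * ‖T j‖ ≤ |q| ^ j * (A * (P * (M ^ j / j.factorial))) := by
          gcongr
          exact hTn j
      _ = A * P * ((|q| * M) ^ j / j.factorial) := by rw [mul_pow]; ring
  · rw [hT']
    have hx : Integrable (fun r => ‖x r‖) (volume.restrict Ω) :=
      ((Lp.memLp x).integrable (by norm_num)).norm
    have hbound : ∀ j : ℕ, ∀ᵐ r ∂(volume.restrict Ω),
        ‖(q : ℂ) ^ j * (waveCoeff ρ κ ξ j r * x r)‖ ≤
          P * ((|q| * M) ^ j / j.factorial) * ‖x r‖ := fun j => by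
      filter_upwards [hb j] with r hr
      rw [norm_mul, norm_mul, norm_pow, Complex.norm_real, Real.norm_eq_abs]
      calc |q| ^ j * (‖waveCoeff ρ κ ξ j r‖ * ‖x r‖)
          ≤ |q| ^ j * (P * (M ^ j / j.factorial) * ‖x r‖) := by gcongr
        _ = _ := by rw [mul_pow]; ring
    -- For a fixed `x` the sum and the integral are exchanged; the exponential series times `‖x‖`
    -- dominates.
    have h := hasSum_integral_of_dominated_convergence
      (F := fun (j : ℕ) (r : Plane) => (q : ℂ) ^ j * (waveCoeff ρ κ ξ j r * x r))
      (f := fun r => (ρ r : ℂ) * planeWave (ξ - q • κ) r * x r) (μ := volume.restrict Ω)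
      (fun j r => P * ((|q| * M) ^ j / j.factorial) * ‖x r‖)
      (fun j => ((measurable_waveCoeff hρ κ ξ j).aestronglyMeasurable.mul
        (Lp.aestronglyMeasurable x)).const_mul _) hbound
      (Filter.Eventually.of_forall fun r => (hexp.mul_left P).mul_right _) ?_
      (Filter.Eventually.of_forall fun r => ?_)
    · refine h.congr_fun fun j => ?_
      rw [integral_const_mul, hT]
    · simp_rw [tsum_mul_right]
      exact hx.const_mul _
    · refine ((hasSum_waveCoeff ρ κ ξ r q).mul_right (x r)).congr_fun fun j => ?_
      ring

/-! ### Completeness of the plane waves on the cell -/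

/-- The reciprocal lattice of the rectangular lattice with side lengths `τ₁`, `τ₂`. -/
def reciprocalNode (τ₁ τ₂ : ℝ) (n : ℤ × ℤ) : Plane :=
  (2 * Real.pi * n.1 / τ₁, 2 * Real.pi * n.2 / τ₂)

theorem setIntegral_exp_Ioo {τ : ℝ} (hτ : 0 < τ) (n : ℤ) :
    ∫ x in Ioo (-(τ / 2)) (τ / 2), Complex.exp (Complex.I * ((2 * Real.pi * n / τ * x : ℝ) : ℂ)) =
      if n = 0 then (τ : ℂ) else 0 := by
  rw [← integral_Ioc_eq_integral_Ioo, ← intervalIntegral.integral_of_le (by linarith)]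
  split_ifs with h
  · subst h
    simp
  · have hτ' : (τ : ℂ) ≠ 0 := by exact_mod_cast hτ.ne'
    have hc : Complex.I * ((2 * Real.pi * n / τ : ℝ) : ℂ) ≠ 0 := by
      simp [h, hτ.ne', Real.pi_ne_zero]
    have h1 := integral_exp_mul_complex (a := -(τ / 2)) (b := τ / 2) hc
    simp only [Complex.ofReal_mul (2 * Real.pi * n / τ), ← mul_assoc]
    rw [h1, div_eq_zero_iff]
    left
    rw [sub_eq_zero, Complex.exp_eq_exp_iff_exists_int]
    -- The exponents at the two endpoints differ by exactly `n` periods `2πi`.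
    refine ⟨n, ?_⟩
    push_cast
    field_simp
    ring

theorem planeWave_eq_mul (k r : Plane) : planeWave k r =
    Complex.exp (Complex.I * ((k.1 * r.1 : ℝ) : ℂ)) *
      Complex.exp (Complex.I * ((k.2 * r.2 : ℝ) : ℂ)) := by
  rw [planeWave, ← Complex.exp_add]
  congr 1
  push_cast
  ring

theorem planeWave_add_left (k l r : Plane) :
    planeWave (k + l) r = planeWave k r * planeWave l r := by
  rw [planeWave, planeWave, planeWave, ← Complex.exp_add]
  congr 1
  simp only [Prod.fst_add, Prod.snd_add]
  push_cast
  ring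

theorem star_planeWave (k r : Plane) : star (planeWave k r) = planeWave (-k) r := by
  rw [planeWave, planeWave, Complex.star_def, ← Complex.exp_conj]
  congr 1
  rw [map_mul, Complex.conj_I, Complex.conj_ofReal]
  simp only [Prod.fst_neg, Prod.snd_neg]
  push_cast
  ring

theorem integral_cell_planeWave {τ₁ τ₂ : ℝ} (h₁ : 0 < τ₁) (h₂ : 0 < τ₂) (n : ℤ × ℤ) :
    ∫ r in cell τ₁ τ₂, planeWave (reciprocalNode τ₁ τ₂ n) r =
      if n = 0 then ((τ₁ * τ₂ : ℝ) : ℂ) else 0 := by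
  simp_rw [planeWave_eq_mul]
  rw [cell, Measure.volume_eq_prod, setIntegral_prod_mul
    (fun x : ℝ => Complex.exp (Complex.I * (((reciprocalNode τ₁ τ₂ n).1 * x : ℝ) : ℂ)))
    (fun x : ℝ => Complex.exp (Complex.I * (((reciprocalNode τ₁ τ₂ n).2 * x : ℝ) : ℂ)))]
  simp only [reciprocalNode]
  rw [setIntegral_exp_Ioo h₁, setIntegral_exp_Ioo h₂]
  rcases n with ⟨n, m⟩
  by_cases hn : n = 0 <;> by_cases hm : m = 0 <;> simp [hn, hm]

theorem measurableSet_cell (τ₁ τ₂ : ℝ) : MeasurableSet (cell τ₁ τ₂) :=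
  measurableSet_Ioo.prod measurableSet_Ioo

theorem volume_cell {τ₁ τ₂ : ℝ} :
    volume (cell τ₁ τ₂) = ENNReal.ofReal τ₁ * ENNReal.ofReal τ₂ := by
  rw [cell, Measure.volume_eq_prod, Measure.prod_prod, Real.volume_Ioo, Real.volume_Ioo]
  ring_nf

instance (τ₁ τ₂ : ℝ) : IsFiniteMeasure (volume.restrict (cell τ₁ τ₂)) := by
  constructor
  rw [Measure.restrict_apply_univ, volume_cell]
  exact ENNReal.mul_lt_top ENNReal.ofReal_lt_top ENNReal.ofReal_lt_top

section Torus

variable {τ₁ τ₂ : ℝ}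

/-- The exponential monomials on a product of two circles. -/
def torusFourier (τ₁ τ₂ : ℝ) (n : ℤ × ℤ) : C(AddCircle τ₁ × AddCircle τ₂, ℂ) where
  toFun t := fourier n.1 t.1 * fourier n.2 t.2
  continuous_toFun := by fun_prop

/-- The monomials contain `1` and are closed under multiplication, so products add nothing to their
span. -/
theorem span_torusFourier_eq_adjoin (τ₁ τ₂ : ℝ) :
    Subalgebra.toSubmodule (Algebra.adjoin ℂ (range (torusFourier τ₁ τ₂))) =
      Submodule.span ℂ (range (torusFourier τ₁ τ₂)) := by
  apply Algebra.adjoin_eq_span_of_subset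
  refine Subset.trans ?_ Submodule.subset_span
  intro x hx
  refine Submonoid.closure_induction (fun _ => id) ⟨0, ?_⟩ ?_ hx
  · ext z
    simp [torusFourier]
  · rintro - - - - ⟨m, rfl⟩ ⟨n, rfl⟩
    refine ⟨m + n, ?_⟩
    ext z
    simp only [torusFourier, ContinuousMap.coe_mk, ContinuousMap.mul_apply, Prod.fst_add,
      Prod.snd_add, fourier_add]
    ring

/-- Stone–Weierstrass: the generated algebra is closed under conjugation, and the monomials of index
`(1, 0)` and `(0, 1)` already separate points. -/
theorem closure_span_torusFourier [Fact (0 < τ₁)] [Fact (0 < τ₂)] :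
    (Submodule.span ℂ (range (torusFourier τ₁ τ₂))).topologicalClosure = ⊤ := by
  let A : StarSubalgebra ℂ C(AddCircle τ₁ × AddCircle τ₂, ℂ) :=
    { toSubalgebra := Algebra.adjoin ℂ (range (torusFourier τ₁ τ₂))
      star_mem' := by
        change Algebra.adjoin ℂ (range (torusFourier τ₁ τ₂)) ≤
          star (Algebra.adjoin ℂ (range (torusFourier τ₁ τ₂)))
        refine Algebra.adjoin_le ?_
        rintro - ⟨n, rfl⟩
        refine Algebra.subset_adjoin ⟨-n, ?_⟩
        ext z
        simp only [torusFourier, ContinuousMap.coe_mk, Prod.fst_neg, Prod.snd_neg, fourier_neg,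
          ContinuousMap.star_apply, star_mul', RCLike.star_def] }
  have hA : A.SeparatesPoints := by
    intro x y hxy
    by_cases h : x.1 = y.1
    · have h2 : x.2 ≠ y.2 := fun h' => hxy (Prod.ext h h')
      refine ⟨_, ⟨torusFourier τ₁ τ₂ (0, 1), Algebra.subset_adjoin ⟨(0, 1), rfl⟩, rfl⟩, ?_⟩
      simp only [torusFourier, ContinuousMap.coe_mk]
      rw [fourier_zero, fourier_zero, one_mul, one_mul, fourier_one, fourier_one]
      intro h3
      exact h2 (AddCircle.injective_toCircle (Fact.out : 0 < τ₂).ne' (Subtype.coe_injective h3))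
    · refine ⟨_, ⟨torusFourier τ₁ τ₂ (1, 0), Algebra.subset_adjoin ⟨(1, 0), rfl⟩, rfl⟩, ?_⟩
      simp only [torusFourier, ContinuousMap.coe_mk]
      rw [fourier_zero, fourier_zero, mul_one, mul_one, fourier_one, fourier_one]
      intro h3
      exact h (AddCircle.injective_toCircle (Fact.out : 0 < τ₁).ne' (Subtype.coe_injective h3))
  rw [← span_torusFourier_eq_adjoin]
  exact congr_arg (Subalgebra.toSubmodule <| StarSubalgebra.toSubalgebra ·)
    (ContinuousMap.starSubalgebra_topologicalClosure_eq_top_of_separatesPoints A hA)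

/-- Uniform density of the trigonometric polynomials passes to `L²`, and only zero is orthogonal to
a dense subspace. -/
theorem eq_zero_of_torusFourier_orthogonal [Fact (0 < τ₁)] [Fact (0 < τ₂)]
    {g : AddCircle τ₁ × AddCircle τ₂ → ℂ} (hg : MemLp g 2 volume)
    (h : ∀ n, ∫ t, torusFourier τ₁ τ₂ n t * g t = 0) : g =ᵐ[volume] 0 := by
  let L := ContinuousMap.toLp (E := ℂ) 2 (volume : Measure (AddCircle τ₁ × AddCircle τ₂)) ℂ
  have hdense : (Submodule.span ℂ (range fun n => L (torusFourier τ₁ τ₂ n))).topologicalClosure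
      = ⊤ := by
    have h1 := (ContinuousMap.toLp_denseRange ℂ (volume : Measure (AddCircle τ₁ × AddCircle τ₂)) ℂ
      (p := 2) (by simp)).topologicalClosure_map_submodule closure_span_torusFourier
    rw [Submodule.map_span, ← range_comp] at h1
    exact h1
  have h0 : hg.toLp = 0 := by
    have h2 : hg.toLp ∈ (Submodule.span ℂ (range fun n => L (torusFourier τ₁ τ₂ n)))ᗮ := by
      refine (Submodule.mem_orthogonal _ _).2 fun u hu => ?_
      induction hu using Submodule.span_induction with
      | mem x hx =>
        obtain ⟨n, rfl⟩ := hx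
        rw [L2.inner_def, ← h (-n)]
        refine integral_congr_ae ?_
        filter_upwards [hg.coeFn_toLp, ContinuousMap.coeFn_toLp (p := 2) (𝕜 := ℂ) volume
          (torusFourier τ₁ τ₂ n)] with t ht ht'
        change inner ℂ (L (torusFourier τ₁ τ₂ n) t) _ = _
        rw [ht, ht', RCLike.inner_apply]
        simp only [torusFourier, ContinuousMap.coe_mk, Prod.fst_neg, Prod.snd_neg, fourier_neg,
          map_mul]
        ring
      | zero => exact inner_zero_left _
      | add x y _ _ hx hy => rw [inner_add_left, hx, hy, add_zero]
      | smul c x _ hx => rw [inner_smul_left, hx, mul_zero]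
    rw [(Submodule.topologicalClosure_eq_top_iff).1 hdense] at h2
    exact (Submodule.mem_bot ℂ).1 h2
  have h3 := hg.coeFn_toLp
  rw [h0] at h3
  exact h3.symm.trans (Lp.coeFn_zero ℂ 2 volume)

end Torus

theorem cell_ae_eq_Ioc {τ₁ τ₂ : ℝ} : cell τ₁ τ₂ =ᵐ[volume]
    (Ioc (-(τ₁ / 2)) (τ₁ / 2) ×ˢ Ioc (-(τ₂ / 2)) (τ₂ / 2) : Set Plane) := by
  rw [cell, Measure.volume_eq_prod]
  exact Measure.set_prod_ae_eq Ioo_ae_eq_Ioc Ioo_ae_eq_Ioc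

/-- Up to a null set the cell is a half-open rectangle, which the quotient map `p` carries to the
torus preserving measure. The measurable section `s` moves `f` to the torus, where completeness is
known. -/
theorem eq_zero_of_planeWave_orthogonal {τ₁ τ₂ : ℝ} (h₁ : 0 < τ₁) (h₂ : 0 < τ₂)
    {f : Lp ℂ 2 (volume.restrict (cell τ₁ τ₂))}
    (h : ∀ n, ∫ r in cell τ₁ τ₂, planeWave (reciprocalNode τ₁ τ₂ n) r * f r = 0) : f = 0 := by
  have : Fact (0 < τ₁) := ⟨h₁⟩
  have : Fact (0 < τ₂) := ⟨h₂⟩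
  set Q : Set Plane := Ioc (-(τ₁ / 2)) (-(τ₁ / 2) + τ₁) ×ˢ Ioc (-(τ₂ / 2)) (-(τ₂ / 2) + τ₂)
    with hQ
  have hQm : MeasurableSet Q := measurableSet_Ioc.prod measurableSet_Ioc
  have hcell : volume.restrict (cell τ₁ τ₂) = volume.restrict Q := by
    rw [Measure.restrict_congr_set cell_ae_eq_Ioc, hQ]
    congr 3 <;> ring
  let p : Plane → AddCircle τ₁ × AddCircle τ₂ := Prod.map (↑) (↑)
  have hp : MeasurePreserving p (volume.restrict Q) volume := by
    have := (AddCircle.measurePreserving_mk τ₁ (-(τ₁ / 2))).prod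
      (AddCircle.measurePreserving_mk τ₂ (-(τ₂ / 2)))
    rwa [Measure.prod_restrict] at this
  let s : AddCircle τ₁ × AddCircle τ₂ → Plane := fun t =>
    (AddCircle.measurableEquivIoc τ₁ (-(τ₁ / 2)) t.1, AddCircle.measurableEquivIoc τ₂ (-(τ₂ / 2)) t.2)
  have hs : Measurable s := by
    have := (AddCircle.measurableEquivIoc τ₁ (-(τ₁ / 2))).measurable
    have := (AddCircle.measurableEquivIoc τ₂ (-(τ₂ / 2))).measurable
    fun_prop
  have hsp : ∀ r ∈ Q, s (p r) = r := by
    rintro ⟨x, y⟩ ⟨hx, hy⟩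
    refine Prod.ext ?_ ?_
    · exact congr_arg Subtype.val
        ((AddCircle.measurableEquivIoc τ₁ (-(τ₁ / 2))).apply_symm_apply ⟨x, hx⟩)
    · exact congr_arg Subtype.val
        ((AddCircle.measurableEquivIoc τ₂ (-(τ₂ / 2))).apply_symm_apply ⟨y, hy⟩)
  have hfs : StronglyMeasurable (f ∘ s) := (Lp.stronglyMeasurable f).comp_measurable hs
  have hcomp : (f ∘ s) ∘ p =ᵐ[volume.restrict Q] f := by
    filter_upwards [ae_restrict_mem hQm] with r hr
    simp [hsp r hr]
  have hmem : MemLp (f ∘ s) 2 volume := by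
    rw [← hp.map_eq, memLp_map_measure_iff hfs.aestronglyMeasurable hp.measurable.aemeasurable,
      memLp_congr_ae hcomp, ← hcell]
    exact Lp.memLp f
  have hzero := eq_zero_of_torusFourier_orthogonal hmem fun n => by
    have hint := integral_map (μ := volume.restrict Q) (f := fun t => torusFourier τ₁ τ₂ n t *
      (f ∘ s) t) hp.measurable.aemeasurable
      ((torusFourier τ₁ τ₂ n).continuous.aestronglyMeasurable.mul hfs.aestronglyMeasurable)
    rw [hp.map_eq] at hint
    rw [← h n, hint]
    simp only [hcell]
    refine integral_congr_ae ?_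
    filter_upwards [hcomp] with r hr
    have hr' : f (s (p r)) = f r := hr
    rw [Function.comp, hr', planeWave_eq_mul]
    congr 1
    simp only [p, torusFourier, ContinuousMap.coe_mk, Prod.map, fourier_coe_apply, reciprocalNode]
    congr 2 <;> push_cast <;> ring
  have h0 : f =ᵐ[volume.restrict Q] 0 :=
    hcomp.symm.trans (hp.quasiMeasurePreserving.ae_eq_comp hzero)
  rw [← hcell] at h0
  exact (Lp.eq_zero_iff_ae_eq_zero).2 h0

theorem reciprocalNode_sub (τ₁ τ₂ : ℝ) (m n : ℤ × ℤ) :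
    reciprocalNode τ₁ τ₂ (m - n) = reciprocalNode τ₁ τ₂ m + -reciprocalNode τ₁ τ₂ n := by
  ext <;> simp [reciprocalNode] <;> ring

theorem reciprocalNode_neg (τ₁ τ₂ : ℝ) (n : ℤ × ℤ) :
    reciprocalNode τ₁ τ₂ (-n) = -reciprocalNode τ₁ τ₂ n := by
  ext <;> simp [reciprocalNode] <;> ring

theorem memLp_planeWave (τ₁ τ₂ : ℝ) (k : Plane) :
    MemLp (planeWave k) 2 (volume.restrict (cell τ₁ τ₂)) :=
  MemLp.of_bound (continuous_planeWave k).aestronglyMeasurable 1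
    (Filter.Eventually.of_forall fun r => (norm_planeWave k r).le)

/-- Parseval's identity on the cell. -/
theorem exists_hilbertBasis_planeWave {τ₁ τ₂ : ℝ} (h₁ : 0 < τ₁) (h₂ : 0 < τ₂) :
    ∃ (b : HilbertBasis (ℤ × ℤ) ℂ (Lp ℂ 2 (volume.restrict (cell τ₁ τ₂)))) (c : ℂ), c ≠ 0 ∧
      ∀ n (f : Lp ℂ 2 (volume.restrict (cell τ₁ τ₂))), inner ℂ (b n) f =
        c * ∫ r in cell τ₁ τ₂, planeWave (reciprocalNode τ₁ τ₂ (-n)) r * f r := by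
  let v : ℤ × ℤ → Lp ℂ 2 (volume.restrict (cell τ₁ τ₂)) := fun n =>
    (memLp_planeWave τ₁ τ₂ (reciprocalNode τ₁ τ₂ n)).toLp
  have hv : ∀ n (f : Lp ℂ 2 (volume.restrict (cell τ₁ τ₂))), inner ℂ (v n) f =
      ∫ r in cell τ₁ τ₂, planeWave (reciprocalNode τ₁ τ₂ (-n)) r * f r := by
    intro n f
    rw [L2.inner_def]
    refine integral_congr_ae ?_
    filter_upwards [(memLp_planeWave τ₁ τ₂ (reciprocalNode τ₁ τ₂ n)).coeFn_toLp] with r hr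
    rw [RCLike.inner_apply, hr, reciprocalNode_neg, ← star_planeWave, mul_comm]
    rfl
  have hpos : 0 < τ₁ * τ₂ := mul_pos h₁ h₂
  -- All plane waves have squared norm `τ₁ τ₂`, so a single factor normalizes them; it becomes the
  -- constant `c`.
  set a : ℝ := (Real.sqrt (τ₁ * τ₂))⁻¹ with ha
  have ha0 : a ≠ 0 := inv_ne_zero (Real.sqrt_pos.2 hpos).ne'
  have ha2 : a * a * (τ₁ * τ₂) = 1 := by
    rw [ha, ← mul_inv, Real.mul_self_sqrt hpos.le, inv_mul_cancel₀ hpos.ne']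
  have horth : Orthonormal ℂ fun n => (a : ℂ) • v n := by
    rw [orthonormal_iff_ite]
    intro m n
    have h3 : inner ℂ (v m) (v n) = if m = n then ((τ₁ * τ₂ : ℝ) : ℂ) else 0 := by
      have h4 : (if m = n then ((τ₁ * τ₂ : ℝ) : ℂ) else 0) =
          if n - m = 0 then ((τ₁ * τ₂ : ℝ) : ℂ) else 0 := by
        simp only [sub_eq_zero, eq_comm]
      rw [hv, h4, ← integral_cell_planeWave h₁ h₂ (n - m)]
      refine integral_congr_ae ?_
      filter_upwards [(memLp_planeWave τ₁ τ₂ (reciprocalNode τ₁ τ₂ n)).coeFn_toLp] with r hr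
      rw [hr, reciprocalNode_neg, reciprocalNode_sub, planeWave_add_left, mul_comm]
    rw [inner_smul_left, inner_smul_right, h3, Complex.conj_ofReal]
    split_ifs
    · rw [← mul_assoc]
      exact_mod_cast ha2
    · simp
  refine ⟨HilbertBasis.mkOfOrthogonalEqBot horth ?_, a, by exact_mod_cast ha0, fun n f => ?_⟩
  · rw [eq_bot_iff]
    intro f hf
    refine (Submodule.mem_bot ℂ).2 (eq_zero_of_planeWave_orthogonal h₁ h₂ fun n => ?_)
    have h4 := (Submodule.mem_orthogonal _ _).1 hf _ (Submodule.subset_span ⟨-n, rfl⟩)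
    rw [inner_smul_left, hv, neg_neg, mul_eq_zero] at h4
    refine h4.resolve_left ?_
    simpa using ha0
  · rw [HilbertBasis.coe_mkOfOrthogonalEqBot, inner_smul_left, hv, Complex.conj_ofReal]

/-! ### Energy argument for the periodic cell problem -/

/-- The `L²` product with a bounded real weight. -/
theorem memLp_weight_mul {α : Type*} [MeasurableSpace α] {μ : Measure α} {ρ : α → ℝ}
    (hρ : Measurable ρ) {P : ℝ} (hP : ∀ r, |ρ r| ≤ P) (f : Lp ℂ 2 μ) :
    MemLp (fun r => (ρ r : ℂ) * f r) 2 μ := by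
  refine (Lp.memLp f).of_le_mul (c := P) ?_ (Filter.Eventually.of_forall fun r => ?_)
  · exact (Complex.measurable_ofReal.comp hρ).aestronglyMeasurable.mul (Lp.aestronglyMeasurable f)
  · rw [norm_mul, Complex.norm_real]
    exact mul_le_mul_of_nonneg_right (hP r) (norm_nonneg _)

/-- Positivity of the weighted `L²` product. -/
theorem re_inner_weight_mul {α : Type*} [MeasurableSpace α] {μ : Measure α} {ρ : α → ℝ}
    (hρ : Measurable ρ) {P : ℝ} (hP : ∀ r, |ρ r| ≤ P) (hpos : ∀ r, 0 < ρ r) (f : Lp ℂ 2 μ) :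
    0 ≤ (inner ℂ (memLp_weight_mul hρ hP f).toLp f : ℂ).re ∧
      ((inner ℂ (memLp_weight_mul hρ hP f).toLp f : ℂ).re = 0 → f = 0) := by
  have h1 : (inner ℂ (memLp_weight_mul hρ hP f).toLp f : ℂ) =
      ((∫ r, ρ r * ‖f r‖ ^ 2 ∂μ : ℝ) : ℂ) := by
    rw [L2.inner_def, ← integral_complex_ofReal]
    refine integral_congr_ae ?_
    filter_upwards [(memLp_weight_mul hρ hP f).coeFn_toLp] with r hr
    rw [hr, RCLike.inner_apply, map_mul, mul_left_comm, RCLike.mul_conj]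
    push_cast
    simp
  rw [h1, Complex.ofReal_re]
  have h0 : ∀ r, 0 ≤ ρ r * ‖f r‖ ^ 2 := fun r => mul_nonneg (hpos r).le (sq_nonneg _)
  refine ⟨integral_nonneg h0, fun h => ?_⟩
  have hint : Integrable (fun r => ρ r * ‖f r‖ ^ 2) μ := by
    refine ((Lp.memLp f).integrable_norm_pow (by norm_num)).bdd_mul (c := P)
      hρ.aestronglyMeasurable (Filter.Eventually.of_forall hP)
  have h2 := (integral_eq_zero_iff_of_nonneg h0 hint).1 h
  refine (Lp.eq_zero_iff_ae_eq_zero).2 ?_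
  filter_upwards [h2] with r hr
  have h3 : ρ r * ‖f r‖ ^ 2 = 0 := hr
  simpa [(hpos r).ne'] using h3

/-- Uniqueness for the periodic cell problem `∇ · (ρ ∇ d) = 0`, in terms of Fourier coefficients. -/
theorem cell_problem_unique {τ₁ τ₂ : ℝ} (h₁ : 0 < τ₁) (h₂ : 0 < τ₂) {ρ : Plane → ℝ}
    (hρ : Measurable ρ) {P : ℝ} (hP : ∀ r, |ρ r| ≤ P) (hpos : ∀ r, 0 < ρ r)
    {d gx gy : Lp ℂ 2 (volume.restrict (cell τ₁ τ₂))}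
    (hx : ∀ n, ∫ r in cell τ₁ τ₂, planeWave (reciprocalNode τ₁ τ₂ n) r * gx r =
      -Complex.I * (reciprocalNode τ₁ τ₂ n).1 *
        ∫ r in cell τ₁ τ₂, planeWave (reciprocalNode τ₁ τ₂ n) r * d r)
    (hy : ∀ n, ∫ r in cell τ₁ τ₂, planeWave (reciprocalNode τ₁ τ₂ n) r * gy r =
      -Complex.I * (reciprocalNode τ₁ τ₂ n).2 *
        ∫ r in cell τ₁ τ₂, planeWave (reciprocalNode τ₁ τ₂ n) r * d r)
    (hdiv : ∀ n, (reciprocalNode τ₁ τ₂ n).1 *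
        (∫ r in cell τ₁ τ₂, (ρ r : ℂ) * planeWave (reciprocalNode τ₁ τ₂ n) r * gx r) +
      (reciprocalNode τ₁ τ₂ n).2 *
        (∫ r in cell τ₁ τ₂, (ρ r : ℂ) * planeWave (reciprocalNode τ₁ τ₂ n) r * gy r) = 0)
    (hmean : ∫ r in cell τ₁ τ₂, d r = 0) : d = 0 ∧ gx = 0 ∧ gy = 0 := by
  obtain ⟨b, c, hc, hb⟩ := exists_hilbertBasis_planeWave h₁ h₂
  have hb' : ∀ n (f : Lp ℂ 2 (volume.restrict (cell τ₁ τ₂))),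
      inner ℂ (b n) (memLp_weight_mul hρ hP f).toLp = c * ∫ r in cell τ₁ τ₂,
        (ρ r : ℂ) * planeWave (reciprocalNode τ₁ τ₂ (-n)) r * f r := by
    intro n f
    rw [hb]
    congr 1
    refine integral_congr_ae ?_
    filter_upwards [(memLp_weight_mul hρ hP f).coeFn_toLp] with r hr
    rw [hr]
    ring
  -- Parseval's expansion of the energy `∫ ρ (|gx|² + |gy|²)`.
  have hsum := (b.hasSum_inner_mul_inner (memLp_weight_mul hρ hP gx).toLp gx).add
    (b.hasSum_inner_mul_inner (memLp_weight_mul hρ hP gy).toLp gy)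
  have hzero : ∀ n, inner ℂ (memLp_weight_mul hρ hP gx).toLp (b n) * inner ℂ (b n) gx +
      inner ℂ (memLp_weight_mul hρ hP gy).toLp (b n) * inner ℂ (b n) gy = (0 : ℂ) := by
    intro n
    rw [← inner_conj_symm _ (b n), ← inner_conj_symm _ (b n), hb', hb', hb, hb, hx, hy]
    have h := congr_arg (starRingEnd ℂ) (hdiv (-n))
    rw [map_add, map_mul, map_mul, map_zero, Complex.conj_ofReal, Complex.conj_ofReal] at h
    rw [map_mul, map_mul]
    -- The gradient relations turn the term at each frequency into a multiple of the conjugate of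
    -- the divergence equation at `-n`.
    linear_combination ((starRingEnd ℂ) c * c * -Complex.I *
      ∫ r in cell τ₁ τ₂, planeWave (reciprocalNode τ₁ τ₂ (-n)) r * d r) * h
  have htot : inner ℂ (memLp_weight_mul hρ hP gx).toLp gx +
      inner ℂ (memLp_weight_mul hρ hP gy).toLp gy = (0 : ℂ) :=
    hsum.unique ((hasSum_zero (α := ℂ)).congr_fun hzero)
  have htot' := congr_arg Complex.re htot
  rw [Complex.add_re, Complex.zero_re] at htot'
  obtain ⟨hx0, hx1⟩ := re_inner_weight_mul hρ hP hpos gx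
  obtain ⟨hy0, hy1⟩ := re_inner_weight_mul hρ hP hpos gy
  have hgx : gx = 0 := hx1 (by linarith)
  have hgy : gy = 0 := hy1 (by linarith)
  refine ⟨eq_zero_of_planeWave_orthogonal h₁ h₂ fun n => ?_, hgx, hgy⟩
  have hz : ∀ n, ∫ r in cell τ₁ τ₂, planeWave (reciprocalNode τ₁ τ₂ n) r *
      (0 : Lp ℂ 2 (volume.restrict (cell τ₁ τ₂))) r = 0 := by
    intro n
    rw [integral_eq_zero_of_ae]
    filter_upwards [Lp.coeFn_zero ℂ 2 (volume.restrict (cell τ₁ τ₂))] with r hr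
    rw [hr]
    simp
  have hxn := hx n
  have hyn := hy n
  rw [hgx, hz, eq_comm, mul_eq_zero] at hxn
  rw [hgy, hz, eq_comm, mul_eq_zero] at hyn
  -- With zero gradient, a Fourier coefficient of `d` can survive only where both components of the
  -- node vanish, that is at `n = 0`, and there it is the mean.
  rcases hxn with hxn | hxn
  · rcases hyn with hyn | hyn
    · have e1 : n.1 = 0 := by
        simpa [reciprocalNode, h₁.ne', Real.pi_ne_zero] using hxn
      have e2 : n.2 = 0 := by
        simpa [reciprocalNode, h₂.ne', Real.pi_ne_zero] using hyn
      rw [← hmean]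
      refine integral_congr_ae (Filter.Eventually.of_forall fun r => ?_)
      simp [reciprocalNode, e1, e2, planeWave]
    · exact hyn
  · exact hxn

/-! ### Weak derivatives in the plane -/

theorem LocallyL2.locallyIntegrable {u : Plane → ℂ} (hu : LocallyL2 u) :
    LocallyIntegrable u volume :=
  locallyIntegrable_iff.2 fun K hK => by
    have : IsFiniteMeasure (volume.restrict K) := ⟨by
      rw [Measure.restrict_apply_univ]
      exact hK.measure_lt_top⟩
    exact (hu K hK).integrable (by norm_num)

theorem LocallyL2.bounded_mul {u w : Plane → ℂ} (hu : LocallyL2 u) (hw : Measurable w) {C : ℝ}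
    (hC : ∀ r, ‖w r‖ ≤ C) : LocallyL2 fun r => w r * u r := fun K hK => by
  refine (hu K hK).of_le_mul (c := C) (hw.aestronglyMeasurable.mul (hu K hK).1)
    (Filter.Eventually.of_forall fun r => ?_)
  rw [norm_mul]
  exact mul_le_mul_of_nonneg_right (hC r) (norm_nonneg _)

theorem isTestFunction_ofReal {Ω : Set Plane} {g : Plane → ℝ} (hg : ContDiff ℝ ∞ g)
    (hc : HasCompactSupport g) (hs : tsupport g ⊆ Ω) :
    IsTestFunction Ω fun r => (g r : ℂ) where
  smooth := Complex.ofRealCLM.contDiff.comp hg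
  compact_support := hc.comp_left Complex.ofReal_zero
  support_subset := (tsupport_comp_subset Complex.ofReal_zero g).trans hs

/-- The weak derivative is unique. -/
theorem HasWeakPartial.unique {Ω : Set Plane} (hΩ : IsOpen Ω) {e : Plane} {u g g' : Plane → ℂ}
    (h : HasWeakPartial Ω e u g) (h' : HasWeakPartial Ω e u g')
    (hg : LocallyIntegrableOn g Ω volume) (hg' : LocallyIntegrableOn g' Ω volume) :
    g =ᵐ[volume.restrict Ω] g' := by
  have key : ∀ᵐ r ∂volume, r ∈ Ω → (g - g') r = 0 := by
    refine IsOpen.ae_eq_zero_of_integral_contDiff_smul_eq_zero hΩ (hg.sub hg') ?_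
    intro φ hφ hc hs
    have ht := isTestFunction_ofReal hφ hc hs
    have h1 : ∀ k : Plane → ℂ, LocallyIntegrableOn k Ω volume →
        Integrable fun r => φ r • k r := fun k hk => by
      have h2 : IntegrableOn (fun r => φ r • k r) (tsupport φ) volume :=
        (hk.integrableOn_compact_subset hs hc).continuousOn_smul
          hφ.continuous.continuousOn hc
      refine (integrableOn_iff_integrable_of_support_subset ?_).1 h2
      exact (Function.support_smul_subset_left _ _).trans (subset_tsupport φ)
    have h2 : ∀ k : Plane → ℂ, ∫ r, φ r • k r = ∫ r in Ω, k r * (φ r : ℂ) := fun k => by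
      rw [← setIntegral_eq_integral_of_forall_compl_eq_zero (s := Ω)]
      · refine integral_congr_ae (Filter.Eventually.of_forall fun r => ?_)
        simp [mul_comm]
      · intro r hr
        rw [image_eq_zero_of_notMem_tsupport fun hr' => hr (hs hr'), zero_smul]
    simp only [Pi.sub_apply, smul_sub]
    rw [integral_sub (h1 g hg) (h1 g' hg'), h2, h2, sub_eq_zero]
    exact neg_injective ((h _ ht).symm.trans (h' _ ht))
  rw [Filter.EventuallyEq, ae_restrict_iff' hΩ.measurableSet]
  filter_upwards [key] with r hr hrΩ
  exact sub_eq_zero.1 (hr hrΩ)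

theorem isTestFunction_translate {φ : Plane → ℂ} (hφ : IsTestFunction univ φ) (τ : Plane) :
    IsTestFunction univ fun r => φ (r - τ) where
  smooth := hφ.smooth.comp (contDiff_id.sub contDiff_const)
  compact_support := hφ.compact_support.comp_homeomorph (Homeomorph.subRight τ)
  support_subset := subset_univ _

theorem locallyL2_translate {u : Plane → ℂ} (hu : LocallyL2 u) (τ : Plane) :
    LocallyL2 fun r => u (r + τ) := fun K hK => by
  have hK' : IsCompact ((fun r => r + τ) '' K) := hK.image (by fun_prop)
  have hmp : MeasurePreserving (fun r : Plane => r + τ) (volume.restrict K)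
      (volume.restrict ((fun r => r + τ) '' K)) := by
    have h := (measurePreserving_add_right (volume : Measure Plane) τ).restrict_image_emb
      (measurableEmbedding_addRight τ) K
    exact h
  exact (hu _ hK').comp_measurePreserving hmp

/-- The weak gradient inherits quasiperiodicity. -/
theorem HasWeakPartial.quasiperiodic {e : Plane} {u g : Plane → ℂ}
    (h : HasWeakPartial univ e u g) (hg : LocallyL2 g) {τ : Plane} {c : ℂ}
    (hu : ∀ᵐ r, u (r + τ) = c * u r) : ∀ᵐ r, g (r + τ) = c * g r := by
  have h1 : HasWeakPartial univ e (fun r => c * u r) (fun r => c * g r) := by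
    intro φ hφ
    simp_rw [mul_assoc]
    rw [integral_const_mul, integral_const_mul, h φ hφ, mul_neg]
  -- Moving the translation onto the test function shows that the translate of `g` is also a weak
  -- derivative of `c * u`; uniqueness then applies.
  have h2 : HasWeakPartial univ e (fun r => c * u r) (fun r => g (r + τ)) := by
    intro φ hφ
    have h3 := h _ (isTestFunction_translate hφ τ)
    simp only [Measure.restrict_univ] at h3 ⊢
    rw [← integral_add_right_eq_self _ τ, ← integral_add_right_eq_self (fun r => g r * φ (r - τ)) τ]
      at h3
    simp only [fderiv_comp_sub, add_sub_cancel_right] at h3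
    rw [← h3]
    refine integral_congr_ae ?_
    filter_upwards [hu] with r hr
    rw [hr]
  have hc : LocallyL2 fun r => c * g r :=
    hg.bounded_mul measurable_const (fun _ => le_rfl)
  have := h2.unique isOpen_univ h1 ((locallyL2_translate hg τ).locallyIntegrable.locallyIntegrableOn _)
    (hc.locallyIntegrable.locallyIntegrableOn _)
  rwa [Measure.restrict_univ] at this

/-! ### Unfolding plane integrals onto the cell -/

/-- The indices of the nodes nearest to the origin. -/
def nearNodes : Finset (ℤ × ℤ) := Finset.Icc (-1) 1 ×ˢ Finset.Icc (-1) 1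

/-- Nine translates of the cell cover the rectangle that carries `F`. Half-open versions of them are
disjoint and differ from the open ones by null sets. -/
theorem integral_eq_sum_cell {τ₁ τ₂ : ℝ} (h₁ : 0 < τ₁) (h₂ : 0 < τ₂) {F : Plane → ℂ}
    (hF : Integrable F) (hsupp : ∀ r, r ∉ Icc (-τ₁) τ₁ ×ˢ Icc (-τ₂) τ₂ → F r = 0) :
    ∫ r, F r = ∑ p ∈ nearNodes, ∫ r in cell τ₁ τ₂, F (r + latticeNode τ₁ τ₂ p.1 p.2) := by
  let I : ℝ → ℤ → Set ℝ := fun τ m => Ioc (-(τ / 2) + m * τ) (-(τ / 2) + (m + 1) * τ)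
  have hdisj : ∀ τ : ℝ, 0 < τ → ∀ m n : ℤ, m ≠ n → Disjoint (I τ m) (I τ n) := by
    intro τ hτ m n hmn
    have := pairwise_disjoint_Ioc_add_zsmul (-(τ / 2)) τ hmn
    simpa [I, Function.onFun] using this
  have hcov : ∀ τ : ℝ, 0 < τ → ∀ x ∈ Icc (-τ) τ, ∃ m ∈ Finset.Icc (-1 : ℤ) 1, x ∈ I τ m := by
    intro τ hτ x hx
    by_cases hx1 : x ≤ -(τ / 2)
    · refine ⟨-1, by decide, ?_, ?_⟩ <;> push_cast <;> linarith [hx.1, hx.2]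
    · by_cases hx2 : x ≤ τ / 2
      · refine ⟨0, by decide, ?_, ?_⟩ <;> push_cast <;> linarith [hx.1, hx.2]
      · refine ⟨1, by decide, ?_, ?_⟩ <;> push_cast <;> linarith [hx.1, hx.2]
  let B : ℤ × ℤ → Set Plane := fun p => I τ₁ p.1 ×ˢ I τ₂ p.2
  have hB : ∀ p, MeasurableSet (B p) := fun p => measurableSet_Ioc.prod measurableSet_Ioc
  have hBd : Set.Pairwise (nearNodes : Set (ℤ × ℤ)) (Function.onFun Disjoint B) := by
    intro p _ q _ hpq
    by_cases hp : p.1 = q.1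
    · exact Disjoint.set_prod_right (hdisj τ₂ h₂ _ _ fun h => hpq (Prod.ext hp h)) _ _
    · exact Disjoint.set_prod_left (hdisj τ₁ h₁ _ _ hp) _ _
  have hun : ∫ r in ⋃ p ∈ nearNodes, B p, F r = ∫ r, F r := by
    refine setIntegral_eq_integral_of_forall_compl_eq_zero fun r hr => hsupp r fun hrK => hr ?_
    obtain ⟨m, hm, hxm⟩ := hcov τ₁ h₁ r.1 hrK.1
    obtain ⟨n, hn, hyn⟩ := hcov τ₂ h₂ r.2 hrK.2
    exact mem_biUnion (x := (m, n)) (Finset.mem_coe.2 (Finset.mem_product.2 ⟨hm, hn⟩)) ⟨hxm, hyn⟩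
  rw [← hun, integral_biUnion_finset _ (fun p _ => hB p) hBd (fun p _ => hF.integrableOn)]
  refine Finset.sum_congr rfl fun p _ => ?_
  rw [setIntegral_congr_set cell_ae_eq_Ioc]
  have h := (measurePreserving_add_right (volume : Measure Plane)
    (latticeNode τ₁ τ₂ p.1 p.2)).setIntegral_preimage_emb (measurableEmbedding_addRight _) F (B p)
  rw [← h]
  congr 2
  ext r
  simp only [B, I, latticeNode, mem_preimage, mem_prod, mem_Ioc, Prod.fst_add, Prod.snd_add]
  constructor <;> rintro ⟨⟨_, _⟩, _, _⟩ <;> refine ⟨⟨?_, ?_⟩, ?_, ?_⟩ <;> linarith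

/-- Unfolding the integral of a periodic function times a cutoff. -/
theorem integral_periodic_mul_cutoff {τ₁ τ₂ : ℝ} (h₁ : 0 < τ₁) (h₂ : 0 < τ₂) {F χ : Plane → ℂ}
    (hF : LocallyIntegrable F volume)
    (hper : ∀ m n : ℤ, ∀ᵐ r, F (r + latticeNode τ₁ τ₂ m n) = F r)
    (hχ : Continuous χ) (hsupp : ∀ r, r ∉ Icc (-τ₁) τ₁ ×ˢ Icc (-τ₂) τ₂ → χ r = 0) {s : ℂ}
    (hs : ∀ r ∈ cell τ₁ τ₂, ∑ p ∈ nearNodes, χ (r + latticeNode τ₁ τ₂ p.1 p.2) = s) :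
    ∫ r, F r * χ r = s * ∫ r in cell τ₁ τ₂, F r := by
  have hcs : HasCompactSupport χ :=
    HasCompactSupport.intro (isCompact_Icc.prod isCompact_Icc) hsupp
  have hint := hF.integrable_smul_right_of_hasCompactSupport hχ hcs
  simp only [smul_eq_mul] at hint
  rw [integral_eq_sum_cell h₁ h₂ hint fun r hr => by rw [hsupp r hr, mul_zero]]
  have hae : ∀ p : ℤ × ℤ, (fun r => F (r + latticeNode τ₁ τ₂ p.1 p.2) *
      χ (r + latticeNode τ₁ τ₂ p.1 p.2)) =ᵐ[volume.restrict (cell τ₁ τ₂)]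
      fun r => F r * χ (r + latticeNode τ₁ τ₂ p.1 p.2) := fun p => by
    filter_upwards [ae_restrict_of_ae (hper p.1 p.2)] with r hr
    rw [hr]
  have hint' : ∀ p ∈ nearNodes, Integrable (fun r => F r * χ (r + latticeNode τ₁ τ₂ p.1 p.2))
      (volume.restrict (cell τ₁ τ₂)) := fun p _ => by
    have h := (hint.comp_add_right (latticeNode τ₁ τ₂ p.1 p.2)).integrableOn
      (s := cell τ₁ τ₂)
    exact Integrable.congr h (hae p)
  rw [Finset.sum_congr rfl fun p _ => integral_congr_ae (hae p), ← integral_finsetSum _ hint',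
    ← integral_const_mul]
  refine setIntegral_congr_fun (measurableSet_cell τ₁ τ₂) fun r hr => ?_
  rw [← Finset.mul_sum, hs r hr, mul_comm]

/-- A smooth cutoff whose translates form a partition of unity. -/
theorem exists_cutoff {τ₁ τ₂ : ℝ} (h₁ : 0 < τ₁) (h₂ : 0 < τ₂) : ∃ χ : Plane → ℝ,
    ContDiff ℝ ∞ χ ∧ (∀ r, r ∉ Icc (-τ₁) τ₁ ×ˢ Icc (-τ₂) τ₂ → χ r = 0) ∧
    ∀ r ∈ cell τ₁ τ₂, ∑ p ∈ nearNodes, χ (r + latticeNode τ₁ τ₂ p.1 p.2) = 1 := by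
  -- A difference of consecutive translates of a smooth step: it vanishes off `[-1, 1]`, and its
  -- integer translates telescope to `1`.
  let s : ℝ → ℝ := fun t => Real.smoothTransition (t + 1) - Real.smoothTransition t
  have hs : ContDiff ℝ ∞ s :=
    (Real.smoothTransition.contDiff.comp (contDiff_id.add contDiff_const)).sub
      Real.smoothTransition.contDiff
  have hs0 : ∀ τ : ℝ, 0 < τ → ∀ x, x ∉ Icc (-τ) τ → s (x / τ) = 0 := by
    intro τ hτ x hx
    simp only [s]
    rw [mem_Icc, not_and_or, not_le, not_le] at hx
    rcases hx with hx | hx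
    · have : x / τ < -1 := by rw [div_lt_iff₀ hτ]; linarith
      rw [Real.smoothTransition.zero_of_nonpos (by linarith),
        Real.smoothTransition.zero_of_nonpos (by linarith), sub_zero]
    · have : 1 < x / τ := by rw [lt_div_iff₀ hτ]; linarith
      rw [Real.smoothTransition.one_of_one_le (by linarith),
        Real.smoothTransition.one_of_one_le (by linarith), sub_self]
  have hsum : ∀ τ : ℝ, 0 < τ → ∀ x ∈ Ioo (-(τ / 2)) (τ / 2),
      ∑ m ∈ Finset.Icc (-1 : ℤ) 1, s ((x + m * τ) / τ) = 1 := by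
    intro τ hτ x hx
    have e : ∀ m : ℤ, (x + m * τ) / τ = x / τ + m := fun m => by field_simp
    have l1 : -1 < x / τ := by rw [lt_div_iff₀ hτ]; linarith [hx.1]
    have l2 : x / τ < 1 := by rw [div_lt_iff₀ hτ]; linarith [hx.2]
    have hI : Finset.Icc (-1 : ℤ) 1 = {-1, 0, 1} := by decide
    rw [hI]
    simp only [e, s]
    rw [Finset.sum_insert (by decide), Finset.sum_insert (by decide), Finset.sum_singleton]
    push_cast
    rw [Real.smoothTransition.one_of_one_le (x := x / τ + 1 + 1) (by linarith),
      Real.smoothTransition.zero_of_nonpos (x := x / τ + -1) (by linarith)]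
    simp
  refine ⟨fun r => s (r.1 / τ₁) * s (r.2 / τ₂), ?_, fun r hr => ?_, fun r hr => ?_⟩
  · exact (hs.comp (contDiff_fst.div_const τ₁)).mul (hs.comp (contDiff_snd.div_const τ₂))
  · rw [mem_prod, not_and_or] at hr
    rcases hr with hr | hr
    · simp only [hs0 τ₁ h₁ _ hr, zero_mul]
    · simp only [hs0 τ₂ h₂ _ hr, mul_zero]
  · simp only [nearNodes, Finset.sum_product, latticeNode, Prod.fst_add, Prod.snd_add,
      ← Finset.mul_sum]
    rw [hsum τ₂ h₂ _ hr.2]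
    simp only [mul_one]
    exact hsum τ₁ h₁ _ hr.1

theorem contDiff_planeWave (k : Plane) : ContDiff ℝ ∞ (planeWave k) := by
  have h : ContDiff ℝ ∞ fun r : Plane => k.1 * r.1 + k.2 * r.2 :=
    (contDiff_const.mul contDiff_fst).add (contDiff_const.mul contDiff_snd)
  have h2 : ContDiff ℝ ∞ fun r : Plane => ((k.1 * r.1 + k.2 * r.2 : ℝ) : ℂ) :=
    Complex.ofRealCLM.contDiff.comp h
  exact (contDiff_const.mul h2).cexp

theorem fderiv_planeWave (k r e : Plane) : fderiv ℝ (planeWave k) r e =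
    Complex.I * ((k.1 * e.1 + k.2 * e.2 : ℝ) : ℂ) * planeWave k r := by
  let L : Plane →L[ℝ] ℝ := k.1 • ContinuousLinearMap.fst ℝ ℝ ℝ + k.2 • ContinuousLinearMap.snd ℝ ℝ ℝ
  have h : HasFDerivAt (fun x : Plane => Complex.exp (Complex.I * (Complex.ofRealCLM.comp L) x))
      (Complex.exp (Complex.I * (Complex.ofRealCLM.comp L) r) •
        (Complex.I • (Complex.ofRealCLM.comp L))) r :=
    ((Complex.ofRealCLM.comp L).hasFDerivAt.const_mul Complex.I).cexp
  have h2 : planeWave k = fun x : Plane =>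
      Complex.exp (Complex.I * (Complex.ofRealCLM.comp L) x) := by
    ext x
    simp [planeWave, L]
  rw [h2, h.fderiv]
  simp [L]
  ring

theorem isTestFunction_cutoff_mul {χ : Plane → ℝ} (hχ : ContDiff ℝ ∞ χ) (hc : HasCompactSupport χ)
    (l : Plane) : IsTestFunction univ fun r => (χ r : ℂ) * planeWave l r where
  smooth := (Complex.ofRealCLM.contDiff.comp hχ).mul (contDiff_planeWave l)
  compact_support := (hc.comp_left (g := fun x : ℝ => (x : ℂ)) Complex.ofReal_zero).mul_right
  support_subset := subset_univ _

theorem fderiv_cutoff_mul {χ : Plane → ℝ} (hχ : ContDiff ℝ ∞ χ) (l r e : Plane) :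
    fderiv ℝ (fun r => (χ r : ℂ) * planeWave l r) r e = (fderiv ℝ χ r e : ℂ) * planeWave l r +
      Complex.I * ((l.1 * e.1 + l.2 * e.2 : ℝ) : ℂ) * ((χ r : ℂ) * planeWave l r) := by
  have h1 : HasFDerivAt (fun r => (χ r : ℂ)) (Complex.ofRealCLM.comp (fderiv ℝ χ r)) r :=
    Complex.ofRealCLM.hasFDerivAt.comp r (hχ.differentiable (by simp) r).hasFDerivAt
  have h2 := ((contDiff_planeWave l).differentiable (by simp) r).hasFDerivAt
  have h3 : HasFDerivAt (fun r => (χ r : ℂ) * planeWave l r) _ r := h1.mul h2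
  rw [h3.fderiv]
  simp only [add_apply, smul_apply, fderiv_planeWave, smul_eq_mul,
    ContinuousLinearMap.comp_apply, Complex.ofRealCLM_apply]
  ring

/-- Differentiate the partition of unity inside the open cell. After unfolding, this removes every
term in which the derivative falls on the cutoff. -/
theorem sum_fderiv_cutoff {τ₁ τ₂ : ℝ} {χ : Plane → ℝ} (hχ : ContDiff ℝ ∞ χ)
    (hs : ∀ r ∈ cell τ₁ τ₂, ∑ p ∈ nearNodes, χ (r + latticeNode τ₁ τ₂ p.1 p.2) = 1) (e : Plane) :
    ∀ r ∈ cell τ₁ τ₂, ∑ p ∈ nearNodes,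
      ((fderiv ℝ χ (r + latticeNode τ₁ τ₂ p.1 p.2) e : ℝ) : ℂ) = 0 := by
  intro r hr
  have hopen : IsOpen (cell τ₁ τ₂) := isOpen_Ioo.prod isOpen_Ioo
  have h1 : (fun r => ∑ p ∈ nearNodes, χ (r + latticeNode τ₁ τ₂ p.1 p.2)) =ᶠ[nhds r]
      fun _ => (1 : ℝ) := by
    filter_upwards [hopen.mem_nhds hr] with x hx using hs x hx
  have h2 : HasFDerivAt (fun r => ∑ p ∈ nearNodes, χ (r + latticeNode τ₁ τ₂ p.1 p.2))
      (∑ p ∈ nearNodes, fderiv ℝ χ (r + latticeNode τ₁ τ₂ p.1 p.2)) r := by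
    refine HasFDerivAt.fun_sum fun p _ => ?_
    exact (hasFDerivAt_comp_add_right _).2 (hχ.differentiable (by simp) _).hasFDerivAt
  have h3 := h1.fderiv_eq (𝕜 := ℝ)
  rw [h2.fderiv, (hasFDerivAt_const (1 : ℝ) r).fderiv] at h3
  have h4 := congr_arg (fun L : Plane →L[ℝ] ℝ => L e) h3
  rw [sum_apply, zero_apply] at h4
  exact_mod_cast h4

theorem norm_planeWave_le (l r : Plane) : ‖planeWave l r‖ ≤ 1 := (norm_planeWave l r).le

/-- `u` times a plane wave is periodic. -/
def IsBlochPeriodic (τ₁ τ₂ : ℝ) (l : Plane) (u : Plane → ℂ) : Prop :=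
  ∀ m n : ℤ, ∀ᵐ r : Plane, planeWave l (r + latticeNode τ₁ τ₂ m n) *
    u (r + latticeNode τ₁ τ₂ m n) = planeWave l r * u r

/-- The plane integral of a Bloch periodic function against a derivative of a localized plane
wave. -/
theorem integral_mul_fderiv_cutoff {τ₁ τ₂ : ℝ} (h₁ : 0 < τ₁) (h₂ : 0 < τ₂) {χ : Plane → ℝ}
    (hχ : ContDiff ℝ ∞ χ) (hsupp : ∀ r, r ∉ Icc (-τ₁) τ₁ ×ˢ Icc (-τ₂) τ₂ → χ r = 0)
    (hs : ∀ r ∈ cell τ₁ τ₂, ∑ p ∈ nearNodes, χ (r + latticeNode τ₁ τ₂ p.1 p.2) = 1)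
    {u : Plane → ℂ} (hu : LocallyL2 u) {l : Plane} (hper : IsBlochPeriodic τ₁ τ₂ l u) :
    (∫ r, u r * ((χ r : ℂ) * planeWave l r) = ∫ r in cell τ₁ τ₂, planeWave l r * u r) ∧
    ∀ e : Plane, ∫ r, u r * fderiv ℝ (fun r => (χ r : ℂ) * planeWave l r) r e =
      Complex.I * ((l.1 * e.1 + l.2 * e.2 : ℝ) : ℂ) * ∫ r in cell τ₁ τ₂, planeWave l r * u r := by
  have hloc := (hu.bounded_mul (continuous_planeWave l).measurable
    (norm_planeWave_le l)).locallyIntegrable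
  have hK : HasCompactSupport χ :=
    HasCompactSupport.intro (isCompact_Icc.prod isCompact_Icc) hsupp
  have hKc : IsClosed (Icc (-τ₁) τ₁ ×ˢ Icc (-τ₂) τ₂ : Set Plane) := isClosed_Icc.prod isClosed_Icc
  have hcast : Continuous fun r => (χ r : ℂ) := Complex.continuous_ofReal.comp hχ.continuous
  have hχK : ∀ r, r ∉ Icc (-τ₁) τ₁ ×ˢ Icc (-τ₂) τ₂ → (χ r : ℂ) = 0 := fun r hr => by
    rw [hsupp r hr, Complex.ofReal_zero]
  have h1 : ∫ r, planeWave l r * u r * (χ r : ℂ) = 1 * ∫ r in cell τ₁ τ₂, planeWave l r * u r :=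
    integral_periodic_mul_cutoff h₁ h₂ hloc hper hcast hχK fun r hr => by
      exact_mod_cast hs r hr
  have h1' : ∫ r, u r * ((χ r : ℂ) * planeWave l r) = ∫ r in cell τ₁ τ₂, planeWave l r * u r := by
    rw [one_mul] at h1
    rw [← h1]
    exact integral_congr_ae (Filter.Eventually.of_forall fun r => by ring)
  refine ⟨h1', fun e => ?_⟩
  have hDc : Continuous fun r => ((fderiv ℝ χ r e : ℝ) : ℂ) :=
    Complex.continuous_ofReal.comp
      ((hχ.continuous_fderiv (by simp)).clm_apply continuous_const)
  have hD0 : ∀ r, r ∉ Icc (-τ₁) τ₁ ×ˢ Icc (-τ₂) τ₂ → ((fderiv ℝ χ r e : ℝ) : ℂ) = 0 := by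
    intro r hr
    have : χ =ᶠ[nhds r] fun _ => 0 := by
      filter_upwards [hKc.isOpen_compl.mem_nhds hr] with x hx using hsupp x hx
    rw [this.fderiv_eq]
    simp
  have h2 : ∫ r, planeWave l r * u r * ((fderiv ℝ χ r e : ℝ) : ℂ) =
      0 * ∫ r in cell τ₁ τ₂, planeWave l r * u r :=
    integral_periodic_mul_cutoff h₁ h₂ hloc hper hDc hD0 (sum_fderiv_cutoff hχ hs e)
  have hcs : HasCompactSupport fun r => (χ r : ℂ) :=
    HasCompactSupport.intro (isCompact_Icc.prod isCompact_Icc) hχK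
  have hcs' : HasCompactSupport fun r => ((fderiv ℝ χ r e : ℝ) : ℂ) :=
    HasCompactSupport.intro (isCompact_Icc.prod isCompact_Icc) hD0
  have i1 := hloc.integrable_smul_right_of_hasCompactSupport hcast hcs
  have i2 := hloc.integrable_smul_right_of_hasCompactSupport hDc hcs'
  simp only [smul_eq_mul] at i1 i2
  have h3 := integral_add i2 (i1.const_mul (Complex.I * ((l.1 * e.1 + l.2 * e.2 : ℝ) : ℂ)))
  rw [integral_const_mul, h1, h2, zero_mul, zero_add, one_mul] at h3
  rw [← h3]
  refine integral_congr_ae (Filter.Eventually.of_forall fun r => ?_)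
  simp only [fderiv_cutoff_mul hχ]
  ring

/-! ### The permittivity and the equations on the cell -/

theorem permittivity_periodic (τ₁ τ₂ a ε : ℝ) (m n : ℤ) (r : Plane) :
    permittivity τ₁ τ₂ a ε (r + latticeNode τ₁ τ₂ m n) = permittivity τ₁ τ₂ a ε r := by
  have h : r + latticeNode τ₁ τ₂ m n ∈ inclusions τ₁ τ₂ a ↔ r ∈ inclusions τ₁ τ₂ a := by
    simp only [inclusions, latticeNode, mem_ofPred_eq, Prod.fst_add, Prod.snd_add]
    constructor
    · rintro ⟨m', n', h⟩
      refine ⟨m' - m, n' - n, ?_⟩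
      push_cast
      convert! h using 3 <;> ring
    · rintro ⟨m', n', h⟩
      refine ⟨m' + m, n' + n, ?_⟩
      push_cast
      convert! h using 3 <;> ring
  by_cases hr : r ∈ inclusions τ₁ τ₂ a
  · rw [permittivity, permittivity, if_pos hr, if_pos (h.2 hr)]
  · rw [permittivity, permittivity, if_neg hr, if_neg fun h' => hr (h.1 h')]

/-- The lattice of disks is centrally symmetric; besides periodicity, this is the only symmetry of
the medium that enters. -/
theorem permittivity_neg (τ₁ τ₂ a ε : ℝ) (r : Plane) :
    permittivity τ₁ τ₂ a ε (-r) = permittivity τ₁ τ₂ a ε r := by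
  have h : -r ∈ inclusions τ₁ τ₂ a ↔ r ∈ inclusions τ₁ τ₂ a := by
    simp only [inclusions, mem_ofPred_eq, Prod.fst_neg, Prod.snd_neg]
    constructor <;> rintro ⟨m', n', h⟩ <;> refine ⟨-m', -n', ?_⟩ <;> push_cast <;>
      convert! h using 1 <;> ring
  by_cases hr : r ∈ inclusions τ₁ τ₂ a
  · rw [permittivity, permittivity, if_pos hr, if_pos (h.2 hr)]
  · rw [permittivity, permittivity, if_neg hr, if_neg fun h' => hr (h.1 h')]

theorem measurable_permittivity (τ₁ τ₂ a ε : ℝ) : Measurable (permittivity τ₁ τ₂ a ε) := by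
  have h : IsOpen (inclusions τ₁ τ₂ a) := by
    simp only [inclusions, ofPred_exists]
    exact isOpen_iUnion fun m => isOpen_iUnion fun n => isOpen_lt (by fun_prop) (by fun_prop)
  exact Measurable.ite h.measurableSet measurable_const measurable_const

theorem permittivity_pos {τ₁ τ₂ a ε : ℝ} (hε : 0 < ε) (r : Plane) :
    0 < permittivity τ₁ τ₂ a ε r := by
  unfold permittivity
  split_ifs <;> positivity

theorem abs_inv_permittivity_le {τ₁ τ₂ a ε : ℝ} (hε : 0 < ε) (r : Plane) :
    |(permittivity τ₁ τ₂ a ε r)⁻¹| ≤ ε⁻¹ + 1 := by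
  rw [abs_of_pos (inv_pos.2 (permittivity_pos hε r))]
  have := inv_pos.2 hε
  unfold permittivity
  split_ifs
  · linarith
  · rw [inv_one]
    linarith

theorem planeWave_add_right (k r s : Plane) :
    planeWave k (r + s) = planeWave k r * planeWave k s := by
  rw [planeWave, planeWave, planeWave, ← Complex.exp_add]
  congr 1
  simp only [Prod.fst_add, Prod.snd_add]
  push_cast
  ring

theorem planeWave_reciprocalNode {τ₁ τ₂ : ℝ} (h₁ : 0 < τ₁) (h₂ : 0 < τ₂) (n : ℤ × ℤ) (m k : ℤ) :
    planeWave (reciprocalNode τ₁ τ₂ n) (latticeNode τ₁ τ₂ m k) = 1 := by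
  rw [planeWave, Complex.exp_eq_one_iff]
  refine ⟨n.1 * m + n.2 * k, ?_⟩
  simp only [reciprocalNode, latticeNode]
  have : (τ₁ : ℂ) ≠ 0 := by exact_mod_cast h₁.ne'
  have : (τ₂ : ℂ) ≠ 0 := by exact_mod_cast h₂.ne'
  push_cast
  field_simp

/-- The equations on the cell for a Bloch eigenfunction, tested with plane waves. -/
theorem IsBlochEigenfunction.cell_equations {τ₁ τ₂ a ε : ℝ} (h₁ : 0 < τ₁) (h₂ : 0 < τ₂)
    (hε : 0 < ε) {k : Plane} {u : Plane → ℂ} {lam : ℂ}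
    (h : IsBlochEigenfunction τ₁ τ₂ a ε k u lam) {w : H1 (cell τ₁ τ₂)}
    (hw : H1.fn w =ᵐ[volume.restrict (cell τ₁ τ₂)] u) (n : ℤ × ℤ) {l : Plane}
    (hl : l = reciprocalNode τ₁ τ₂ n - k) :
    (∫ r in cell τ₁ τ₂, planeWave l r * (w : L2Triple (cell τ₁ τ₂)) 1 r =
      -Complex.I * l.1 * ∫ r in cell τ₁ τ₂, planeWave l r * (w : L2Triple (cell τ₁ τ₂)) 0 r) ∧
    (∫ r in cell τ₁ τ₂, planeWave l r * (w : L2Triple (cell τ₁ τ₂)) 2 r =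
      -Complex.I * l.2 * ∫ r in cell τ₁ τ₂, planeWave l r * (w : L2Triple (cell τ₁ τ₂)) 0 r) ∧
    Complex.I * l.1 * (∫ r in cell τ₁ τ₂, (((permittivity τ₁ τ₂ a ε r)⁻¹ : ℝ) : ℂ) *
        planeWave l r * (w : L2Triple (cell τ₁ τ₂)) 1 r) +
      Complex.I * l.2 * (∫ r in cell τ₁ τ₂, (((permittivity τ₁ τ₂ a ε r)⁻¹ : ℝ) : ℂ) *
        planeWave l r * (w : L2Triple (cell τ₁ τ₂)) 2 r) =
      lam * ∫ r in cell τ₁ τ₂, planeWave l r * (w : L2Triple (cell τ₁ τ₂)) 0 r := by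
  obtain ⟨gx, gy, hu, hgx, hgy, hx, hy, heq⟩ := h.weak_solution
  have hopen : IsOpen (cell τ₁ τ₂) := isOpen_Ioo.prod isOpen_Ioo
  have hqu : ∀ m j : ℤ, ∀ᵐ r : Plane, u (r + latticeNode τ₁ τ₂ m j) =
      planeWave k (latticeNode τ₁ τ₂ m j) * u r := h.quasiperiodic
  have hqx := fun m j => hx.quasiperiodic hgx (hqu m j)
  have hqy := fun m j => hy.quasiperiodic hgy (hqu m j)
  have hper : ∀ g : Plane → ℂ, (∀ m j : ℤ, ∀ᵐ r : Plane, g (r + latticeNode τ₁ τ₂ m j) =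
      planeWave k (latticeNode τ₁ τ₂ m j) * g r) → IsBlochPeriodic τ₁ τ₂ l g := by
    intro g hg m j
    filter_upwards [hg m j] with r hr
    -- The wave vector `l = ξ - k` cancels the Bloch factor, since reciprocal waves equal `1` at
    -- lattice nodes.
    have e : planeWave l (latticeNode τ₁ τ₂ m j) * planeWave k (latticeNode τ₁ τ₂ m j) = 1 := by
      rw [← planeWave_add_left, hl, sub_add_cancel, planeWave_reciprocalNode h₁ h₂]
    rw [hr, planeWave_add_right]
    linear_combination planeWave l r * g r * e
  have hcong : ∀ {i : Fin 3} {g : Plane → ℂ},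
      (w : L2Triple (cell τ₁ τ₂)) i =ᵐ[volume.restrict (cell τ₁ τ₂)] g → ∀ c : Plane → ℂ,
      ∫ r in cell τ₁ τ₂, c r * (w : L2Triple (cell τ₁ τ₂)) i r =
        ∫ r in cell τ₁ τ₂, c r * g r := by
    intro i g hg c
    refine integral_congr_ae ?_
    filter_upwards [hg] with r hr
    rw [hr]
  -- The gradient stored in `w` agrees on the cell with the gradient in the plane, because weak
  -- derivatives are unique.
  have hrestrict : ∀ {e : Plane} {g : Plane → ℂ} {i : Fin 3}, LocallyL2 g →
      HasWeakPartial univ e u g →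
      HasWeakPartial (cell τ₁ τ₂) e ((w : L2Triple (cell τ₁ τ₂)) 0)
        ((w : L2Triple (cell τ₁ τ₂)) i) →
      (w : L2Triple (cell τ₁ τ₂)) i =ᵐ[volume.restrict (cell τ₁ τ₂)] g := by
    intro e g i hg hwk hwi
    have hg' : HasWeakPartial (cell τ₁ τ₂) e ((w : L2Triple (cell τ₁ τ₂)) 0) g := by
      intro φ hφ
      have h3 := hwk φ ⟨hφ.smooth, hφ.compact_support, subset_univ _⟩
      simp only [Measure.restrict_univ] at h3
      rw [← setIntegral_eq_integral_of_forall_compl_eq_zero (s := cell τ₁ τ₂)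
          (f := fun r => u r * fderiv ℝ φ r e),
        ← setIntegral_eq_integral_of_forall_compl_eq_zero (s := cell τ₁ τ₂)
          (f := fun r => g r * φ r)] at h3
      · rw [← h3]
        refine integral_congr_ae ?_
        filter_upwards [hw] with r hr
        change H1.fn w r * _ = _
        rw [hr]
      · intro r hr
        rw [image_eq_zero_of_notMem_tsupport fun hr' => hr (hφ.support_subset hr'), mul_zero]
      · intro r hr
        rw [fderiv_of_notMem_tsupport _ fun hr' => hr (hφ.support_subset hr'), zero_apply, mul_zero]
    refine hwi.unique hopen hg' ?_ (hg.locallyIntegrable.locallyIntegrableOn _)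
    have hi : IntegrableOn ((w : L2Triple (cell τ₁ τ₂)) i : Plane → ℂ) (cell τ₁ τ₂) :=
      (Lp.memLp ((w : L2Triple (cell τ₁ τ₂)) i)).integrable (by norm_num)
    exact hi.locallyIntegrableOn
  have e0 : (w : L2Triple (cell τ₁ τ₂)) 0 =ᵐ[volume.restrict (cell τ₁ τ₂)] u := hw
  have e1 := hrestrict hgx hx w.2.1
  have e2 := hrestrict hgy hy w.2.2
  -- A localized plane wave is an admissible test function in the whole plane. Unfolding it gives
  -- the identities on the cell with no traces on its boundary.
  obtain ⟨χ, hχ, hsupp, hs⟩ := exists_cutoff h₁ h₂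
  have hK : HasCompactSupport χ :=
    HasCompactSupport.intro (isCompact_Icc.prod isCompact_Icc) hsupp
  have htest := isTestFunction_cutoff_mul hχ hK l
  have hpm : Measurable fun r => (((permittivity τ₁ τ₂ a ε r)⁻¹ : ℝ) : ℂ) :=
    Complex.measurable_ofReal.comp (measurable_permittivity τ₁ τ₂ a ε).inv
  have hpb : ∀ r, ‖(((permittivity τ₁ τ₂ a ε r)⁻¹ : ℝ) : ℂ)‖ ≤ ε⁻¹ + 1 := fun r => by
    rw [Complex.norm_real]
    exact abs_inv_permittivity_le hε r
  have hperp : ∀ g : Plane → ℂ, IsBlochPeriodic τ₁ τ₂ l g →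
      IsBlochPeriodic τ₁ τ₂ l fun r => (((permittivity τ₁ τ₂ a ε r)⁻¹ : ℝ) : ℂ) * g r := by
    intro g hg m j
    filter_upwards [hg m j] with r hr
    rw [permittivity_periodic]
    linear_combination (((permittivity τ₁ τ₂ a ε r)⁻¹ : ℝ) : ℂ) * hr
  obtain ⟨u1, u2⟩ := integral_mul_fderiv_cutoff h₁ h₂ hχ hsupp hs hu (hper u hqu)
  obtain ⟨x1, -⟩ := integral_mul_fderiv_cutoff h₁ h₂ hχ hsupp hs hgx (hper gx hqx)
  obtain ⟨y1, -⟩ := integral_mul_fderiv_cutoff h₁ h₂ hχ hsupp hs hgy (hper gy hqy)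
  have hpx := hgx.bounded_mul hpm hpb
  have hpy := hgy.bounded_mul hpm hpb
  obtain ⟨-, x2⟩ := integral_mul_fderiv_cutoff h₁ h₂ hχ hsupp hs hpx
    (hperp gx (hper gx hqx))
  obtain ⟨-, y2⟩ := integral_mul_fderiv_cutoff h₁ h₂ hχ hsupp hs hpy
    (hperp gy (hper gy hqy))
  have wx := hx _ htest
  have wy := hy _ htest
  have we := heq _ htest
  simp only [Measure.restrict_univ] at wx wy
  rw [u2, x1] at wx
  rw [u2, y1] at wy
  refine ⟨?_, ?_, ?_⟩
  · rw [hcong e0, hcong e1]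
    simp only [dirX] at wx
    simp only [mul_one, mul_zero, add_zero] at wx
    linear_combination wx
  · rw [hcong e0, hcong e2]
    simp only [dirY] at wy
    simp only [mul_one, mul_zero, zero_add] at wy
    linear_combination wy
  · rw [hcong e0, hcong e1, hcong e2]
    rw [u1] at we
    rw [← we]
    have hi : ∀ {g : Plane → ℂ} (e : Plane), LocallyL2 g →
        Integrable fun r => g r * fderiv ℝ (fun r => (χ r : ℂ) * planeWave l r) r e := by
      intro g e hg
      have := hg.locallyIntegrable.integrable_smul_right_of_hasCompactSupport
        ((htest.smooth.continuous_fderiv (by simp)).clm_apply continuous_const)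
        (htest.compact_support.fderiv_apply ℝ e)
      simpa only [smul_eq_mul] using this
    have hsplit := integral_add (hi dirX hpx) (hi dirY hpy)
    rw [x2, y2] at hsplit
    simp only [dirX, dirY, mul_one, mul_zero, add_zero, zero_add] at hsplit
    have hl : ∀ g : Plane → ℂ, ∫ r in cell τ₁ τ₂, planeWave l r *
        ((((permittivity τ₁ τ₂ a ε r)⁻¹ : ℝ) : ℂ) * g r) =
        ∫ r in cell τ₁ τ₂, (((permittivity τ₁ τ₂ a ε r)⁻¹ : ℝ) : ℂ) * planeWave l r * g r :=
      fun g => integral_congr_ae (Filter.Eventually.of_forall fun r => by ring)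
    rw [hl, hl] at hsplit
    rw [← hsplit]
    refine integral_congr_ae (Filter.Eventually.of_forall fun r => ?_)
    simp only [dirX, dirY]
    push_cast
    ring

/-! ### The hierarchy and its reflection symmetry -/

theorem measurePreserving_neg_cell (τ₁ τ₂ : ℝ) : MeasurePreserving (fun r : Plane => -r)
    (volume.restrict (cell τ₁ τ₂)) (volume.restrict (cell τ₁ τ₂)) := by
  have h := (Measure.measurePreserving_neg (volume : Measure Plane)).restrict_preimage
    (measurableSet_cell τ₁ τ₂)
  have h2 : (Neg.neg : Plane → Plane) ⁻¹' cell τ₁ τ₂ = cell τ₁ τ₂ := by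
    ext r
    simp only [cell, mem_preimage, mem_prod, mem_Ioo, Prod.fst_neg, Prod.snd_neg]
    constructor <;> rintro ⟨⟨_, _⟩, _, _⟩ <;> refine ⟨⟨?_, ?_⟩, ?_, ?_⟩ <;> linarith
  rwa [h2] at h

theorem integral_cell_neg (τ₁ τ₂ : ℝ) (F : Plane → ℂ) :
    ∫ r in cell τ₁ τ₂, F (-r) = ∫ r in cell τ₁ τ₂, F r :=
  (measurePreserving_neg_cell τ₁ τ₂).integral_comp (MeasurableEquiv.neg Plane).measurableEmbedding F

/-- The reflection `f(r) ↦ f(-r)` on `L²` of the cell. -/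
def reflect {τ₁ τ₂ : ℝ} (f : Lp ℂ 2 (volume.restrict (cell τ₁ τ₂))) :
    Lp ℂ 2 (volume.restrict (cell τ₁ τ₂)) :=
  Lp.compMeasurePreserving _ (measurePreserving_neg_cell τ₁ τ₂) f

theorem coeFn_reflect {τ₁ τ₂ : ℝ} (f : Lp ℂ 2 (volume.restrict (cell τ₁ τ₂))) :
    reflect f =ᵐ[volume.restrict (cell τ₁ τ₂)] fun r => f (-r) :=
  Lp.coeFn_compMeasurePreserving _ (measurePreserving_neg_cell τ₁ τ₂)

/-- The coefficient of `q ^ N` in the Fourier coefficient of `ρ exp(-i q κ · r) ∑ q ^ k f k`. -/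
def seriesCoeff {τ₁ τ₂ : ℝ} (ρ : Plane → ℝ) (κ : Plane) (n : ℤ × ℤ)
    (f : ℕ → Lp ℂ 2 (volume.restrict (cell τ₁ τ₂))) (N : ℕ) : ℂ :=
  ∑ p ∈ Finset.HasAntidiagonal.antidiagonal N,
    ∫ r in cell τ₁ τ₂, waveCoeff ρ κ (reciprocalNode τ₁ τ₂ n) p.1 r * f p.2 r

/-- The coefficients of `q` times a power series. -/
def shiftCoeff (c : ℕ → ℂ) : ℕ → ℂ
  | 0 => 0
  | N + 1 => c N

theorem hasSum_shiftCoeff {q s : ℂ} {c : ℕ → ℂ} (h : HasSum (fun k => q ^ k * c k) s) :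
    HasSum (fun k => q ^ k * shiftCoeff c k) (q * s) := by
  rw [← hasSum_nat_add_iff' 1]
  simp only [Finset.range_one, Finset.sum_singleton, shiftCoeff, mul_zero, sub_zero]
  exact (h.mul_left q).congr_fun fun k => by ring

/-- The hierarchy of equations satisfied by the coefficients of the power series of `u`, its
gradient and the eigenvalue, in terms of Fourier coefficients. -/
structure IsCellHierarchy {τ₁ τ₂ : ℝ} (ρ : Plane → ℝ) (κ : Plane)
    (f gx gy : ℕ → Lp ℂ 2 (volume.restrict (cell τ₁ τ₂))) (lam : ℕ → ℂ) : Prop where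
  grad_x : ∀ n N, seriesCoeff (fun _ => 1) κ n gx N =
    -Complex.I * (reciprocalNode τ₁ τ₂ n).1 * seriesCoeff (fun _ => 1) κ n f N +
      Complex.I * κ.1 * shiftCoeff (seriesCoeff (fun _ => 1) κ n f) N
  grad_y : ∀ n N, seriesCoeff (fun _ => 1) κ n gy N =
    -Complex.I * (reciprocalNode τ₁ τ₂ n).2 * seriesCoeff (fun _ => 1) κ n f N +
      Complex.I * κ.2 * shiftCoeff (seriesCoeff (fun _ => 1) κ n f) N
  equation : ∀ n N,
    Complex.I * (reciprocalNode τ₁ τ₂ n).1 * seriesCoeff ρ κ n gx N -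
        Complex.I * κ.1 * shiftCoeff (seriesCoeff ρ κ n gx) N +
      (Complex.I * (reciprocalNode τ₁ τ₂ n).2 * seriesCoeff ρ κ n gy N -
        Complex.I * κ.2 * shiftCoeff (seriesCoeff ρ κ n gy) N) =
    ∑ p ∈ Finset.HasAntidiagonal.antidiagonal N, lam p.1 * seriesCoeff (fun _ => 1) κ n f p.2

/-- The factor in front of the plane wave is a homogeneous polynomial of degree `j` times an even
weight. -/
theorem waveCoeff_neg {ρ : Plane → ℝ} (hρ : ∀ r, ρ (-r) = ρ r) (κ ξ : Plane) (j : ℕ) (r : Plane) :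
    waveCoeff ρ κ ξ j (-r) = (-1) ^ j * waveCoeff ρ κ (-ξ) j r := by
  have h1 : planeWave ξ (-r) = planeWave (-ξ) r := by
    unfold planeWave
    congr 3
    simp only [Prod.fst_neg, Prod.snd_neg]
    ring
  have h2 : (-Complex.I * ((κ.1 * (-r).1 + κ.2 * (-r).2 : ℝ) : ℂ)) ^ j =
      (-1) ^ j * (-Complex.I * ((κ.1 * r.1 + κ.2 * r.2 : ℝ) : ℂ)) ^ j := by
    rw [← mul_pow]
    congr 1
    simp only [Prod.fst_neg, Prod.snd_neg]
    push_cast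
    ring
  rw [waveCoeff, waveCoeff, hρ, h1, h2]
  ring

/-- Along the antidiagonal the sign `(-1) ^ j` of the expanded wave and the sign `(-1) ^ k` of the
sequence combine to `(-1) ^ N`. The factor `s` is `1` for functions and `-1` for gradients, as
differentiation is odd under reflection. -/
theorem seriesCoeff_reflect {τ₁ τ₂ : ℝ} {ρ : Plane → ℝ} (hρ : ∀ r, ρ (-r) = ρ r) (κ : Plane)
    (s : ℂ) (n : ℤ × ℤ) (f : ℕ → Lp ℂ 2 (volume.restrict (cell τ₁ τ₂))) (N : ℕ) :
    seriesCoeff ρ κ n (fun k => (s * (-1) ^ k) • reflect (f k)) N =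
      s * (-1) ^ N * seriesCoeff ρ κ (-n) f N := by
  rw [seriesCoeff, seriesCoeff, Finset.mul_sum]
  refine Finset.sum_congr rfl fun p hp => ?_
  have hpN : p.1 + p.2 = N := Finset.HasAntidiagonal.mem_antidiagonal.1 hp
  rw [← integral_cell_neg, ← integral_const_mul]
  refine integral_congr_ae ?_
  have h2 : ∀ᵐ r ∂volume.restrict (cell τ₁ τ₂),
      ((s * (-1) ^ p.2) • reflect (f p.2) : Lp ℂ 2 (volume.restrict (cell τ₁ τ₂))) r =
        s * (-1) ^ p.2 * f p.2 (-r) := by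
    filter_upwards [Lp.coeFn_smul (s * (-1) ^ p.2) (reflect (f p.2)), coeFn_reflect (f p.2)]
      with r hr hr'
    rw [hr, Pi.smul_apply, hr', smul_eq_mul]
  filter_upwards [(measurePreserving_neg_cell τ₁ τ₂).quasiMeasurePreserving.ae h2] with r hr
  rw [hr, neg_neg, waveCoeff_neg hρ, ← reciprocalNode_neg, ← hpN, pow_add]
  ring

/-- The shift lowers the order by one, hence the extra sign. It matches the sign of `ξ` under `n ↦
-n`, so both parts of `ξ - qκ` transform alike. -/
theorem shiftCoeff_reflect {τ₁ τ₂ : ℝ} {ρ : Plane → ℝ} (hρ : ∀ r, ρ (-r) = ρ r) (κ : Plane)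
    (s : ℂ) (n : ℤ × ℤ) (f : ℕ → Lp ℂ 2 (volume.restrict (cell τ₁ τ₂))) (N : ℕ) :
    shiftCoeff (seriesCoeff ρ κ n (fun k => (s * (-1) ^ k) • reflect (f k))) N =
      -s * (-1) ^ N * shiftCoeff (seriesCoeff ρ κ (-n) f) N := by
  cases N with
  | zero => simp [shiftCoeff]
  | succ N =>
    simp only [shiftCoeff]
    rw [seriesCoeff_reflect hρ]
    ring

/-- The hierarchy is invariant under the reflection `(r, q) ↦ (-r, -q)`. -/
theorem IsCellHierarchy.reflect {τ₁ τ₂ : ℝ} {ρ : Plane → ℝ} {κ : Plane}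
    {f gx gy : ℕ → Lp ℂ 2 (volume.restrict (cell τ₁ τ₂))} {lam : ℕ → ℂ}
    (h : IsCellHierarchy ρ κ f gx gy lam) (hρ : ∀ r, ρ (-r) = ρ r) :
    IsCellHierarchy ρ κ (fun k => ((1 : ℂ) * (-1) ^ k) • reflect (f k))
      (fun k => ((-1 : ℂ) * (-1) ^ k) • _root_.reflect (gx k))
      (fun k => ((-1 : ℂ) * (-1) ^ k) • _root_.reflect (gy k)) (fun k => (-1) ^ k * lam k) where
  grad_x n N := by
    have e := h.grad_x (-n) N
    rw [reciprocalNode_neg] at e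
    rw [seriesCoeff_reflect fun _ => rfl, seriesCoeff_reflect fun _ => rfl,
      shiftCoeff_reflect fun _ => rfl, e]
    simp only [Prod.fst_neg]
    push_cast
    ring
  grad_y n N := by
    have e := h.grad_y (-n) N
    rw [reciprocalNode_neg] at e
    rw [seriesCoeff_reflect fun _ => rfl, seriesCoeff_reflect fun _ => rfl,
      shiftCoeff_reflect fun _ => rfl, e]
    simp only [Prod.snd_neg]
    push_cast
    ring
  equation n N := by
    have e := h.equation (-n) N
    rw [reciprocalNode_neg] at e
    rw [seriesCoeff_reflect hρ, seriesCoeff_reflect hρ, shiftCoeff_reflect hρ,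
      shiftCoeff_reflect hρ]
    have e2 : ∑ p ∈ Finset.HasAntidiagonal.antidiagonal N, (-1) ^ p.1 * lam p.1 *
        seriesCoeff (fun _ => 1) κ n (fun k => ((1 : ℂ) * (-1) ^ k) • _root_.reflect (f k)) p.2 =
        (-1) ^ N * ∑ p ∈ Finset.HasAntidiagonal.antidiagonal N,
          lam p.1 * seriesCoeff (fun _ => 1) κ (-n) f p.2 := by
      rw [Finset.mul_sum]
      refine Finset.sum_congr rfl fun p hp => ?_
      rw [seriesCoeff_reflect fun _ => rfl, ← Finset.HasAntidiagonal.mem_antidiagonal.1 hp, pow_add]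
      ring
    rw [e2, ← e]
    simp only [Prod.fst_neg, Prod.snd_neg]
    push_cast
    ring

/-! ### Uniqueness for the hierarchy -/

theorem waveCoeff_zero (ρ : Plane → ℝ) (κ ξ r : Plane) :
    waveCoeff ρ κ ξ 0 r = (ρ r : ℂ) * planeWave ξ r := by
  simp [waveCoeff]

theorem integral_weight_planeWave_sub {τ₁ τ₂ : ℝ} {ρ : Plane → ℝ} (hρ : Measurable ρ) {P : ℝ}
    (hP : ∀ r, |ρ r| ≤ P) (ξ : Plane) (f f' : Lp ℂ 2 (volume.restrict (cell τ₁ τ₂))) :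
    ∫ r in cell τ₁ τ₂, (ρ r : ℂ) * planeWave ξ r *
        (f - f' : Lp ℂ 2 (volume.restrict (cell τ₁ τ₂))) r =
      (∫ r in cell τ₁ τ₂, (ρ r : ℂ) * planeWave ξ r * f r) -
        ∫ r in cell τ₁ τ₂, (ρ r : ℂ) * planeWave ξ r * f' r := by
  have hi : ∀ g : Lp ℂ 2 (volume.restrict (cell τ₁ τ₂)),
      Integrable (fun r => (ρ r : ℂ) * planeWave ξ r * g r) (volume.restrict (cell τ₁ τ₂)) := by
    intro g
    refine ((Lp.memLp g).integrable (by norm_num)).bdd_mul (c := P) ?_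
      (Filter.Eventually.of_forall fun r => ?_)
    · exact (Complex.measurable_ofReal.comp hρ).aestronglyMeasurable.mul
        (continuous_planeWave ξ).aestronglyMeasurable
    · rw [norm_mul, norm_planeWave, mul_one, Complex.norm_real]
      exact hP r
  rw [← integral_sub (hi f) (hi f')]
  refine integral_congr_ae ?_
  filter_upwards [Lp.coeFn_sub f f'] with r hr
  rw [hr, Pi.sub_apply]
  ring

theorem seriesCoeff_congr {τ₁ τ₂ : ℝ} (ρ : Plane → ℝ) (κ : Plane) (n : ℤ × ℤ)
    {f f' : ℕ → Lp ℂ 2 (volume.restrict (cell τ₁ τ₂))} {N : ℕ} (h : ∀ k ≤ N, f k = f' k) :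
    seriesCoeff ρ κ n f N = seriesCoeff ρ κ n f' N := by
  refine Finset.sum_congr rfl fun p hp => ?_
  rw [h p.2 (by have := Finset.HasAntidiagonal.mem_antidiagonal.1 hp; omega)]

theorem shiftCoeff_congr {c c' : ℕ → ℂ} {N : ℕ} (h : ∀ k < N, c k = c' k) :
    shiftCoeff c N = shiftCoeff c' N := by
  cases N with
  | zero => rfl
  | succ N => exact h N (Nat.lt_succ_self N)

/-- Only the pair `(0, N)` survives, and its wave coefficient has no polynomial factor. The
difference at order `N` is thus an ordinary Fourier coefficient, which reduces each order to a
periodic cell problem. -/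
theorem seriesCoeff_sub {τ₁ τ₂ : ℝ} {ρ : Plane → ℝ} (hρ : Measurable ρ) {P : ℝ}
    (hP : ∀ r, |ρ r| ≤ P) (κ : Plane) (n : ℤ × ℤ)
    {f f' : ℕ → Lp ℂ 2 (volume.restrict (cell τ₁ τ₂))} {N : ℕ} (h : ∀ k < N, f k = f' k) :
    seriesCoeff ρ κ n f N - seriesCoeff ρ κ n f' N =
      ∫ r in cell τ₁ τ₂, (ρ r : ℂ) * planeWave (reciprocalNode τ₁ τ₂ n) r *
        (f N - f' N : Lp ℂ 2 (volume.restrict (cell τ₁ τ₂))) r := by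
  rw [seriesCoeff, seriesCoeff, ← Finset.sum_sub_distrib, Finset.sum_eq_single (0, N)]
  · rw [integral_weight_planeWave_sub hρ hP]
    simp only [waveCoeff_zero]
  · intro p hp hne
    have hpN : p.1 + p.2 = N := Finset.HasAntidiagonal.mem_antidiagonal.1 hp
    have : p.2 < N := by
      by_contra hlt
      exact hne (Prod.ext (by simp only; omega) (by simp only; omega))
    rw [h _ this, sub_self]
  · intro hn
    exact absurd (Finset.HasAntidiagonal.mem_antidiagonal.2 (zero_add N)) hn

/-- A solution of the hierarchy is determined by its mean values. -/
theorem IsCellHierarchy.unique {τ₁ τ₂ : ℝ} (h₁ : 0 < τ₁) (h₂ : 0 < τ₂) {ρ : Plane → ℝ}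
    (hρ : Measurable ρ) {P : ℝ} (hP : ∀ r, |ρ r| ≤ P) (hpos : ∀ r, 0 < ρ r) {κ : Plane}
    {f gx gy f' gx' gy' : ℕ → Lp ℂ 2 (volume.restrict (cell τ₁ τ₂))} {lam lam' : ℕ → ℂ}
    (h : IsCellHierarchy ρ κ f gx gy lam) (h' : IsCellHierarchy ρ κ f' gx' gy' lam')
    (hf0 : f 0 =ᵐ[volume.restrict (cell τ₁ τ₂)] fun _ => 1) (hl : lam 0 = 0) (hl' : lam' 0 = 0)
    (hmean : ∀ N, ∫ r in cell τ₁ τ₂, f N r = ∫ r in cell τ₁ τ₂, f' N r) (N : ℕ) :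
    f N = f' N ∧ gx N = gx' N ∧ gy N = gy' N ∧ lam N = lam' N := by
  induction N using Nat.strong_induction_on with
  | _ N ih =>
    have hone : ∀ r : Plane, |(fun _ => 1 : Plane → ℝ) r| ≤ 1 := fun r => by simp
    have hfs := fun n => seriesCoeff_sub (measurable_const (a := (1 : ℝ))) hone κ n
      fun k hk => (ih k hk).1
    have hxs := fun n => seriesCoeff_sub (measurable_const (a := (1 : ℝ))) hone κ n
      fun k hk => (ih k hk).2.1
    have hys := fun n => seriesCoeff_sub (measurable_const (a := (1 : ℝ))) hone κ n
      fun k hk => (ih k hk).2.2.1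
    have hxρ := fun n => seriesCoeff_sub hρ hP κ n fun k hk => (ih k hk).2.1
    have hyρ := fun n => seriesCoeff_sub hρ hP κ n fun k hk => (ih k hk).2.2.1
    have hlow : ∀ n, ∀ k < N, seriesCoeff (fun _ => 1) κ n f k =
        seriesCoeff (fun _ => 1) κ n f' k := fun n k hk =>
      seriesCoeff_congr _ _ _ fun j hj => (ih j (hj.trans_lt hk)).1
    have hsf := fun n => shiftCoeff_congr (hlow n)
    have hsx : ∀ n, shiftCoeff (seriesCoeff ρ κ n gx) N = shiftCoeff (seriesCoeff ρ κ n gx') N :=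
      fun n => shiftCoeff_congr fun k hk =>
        seriesCoeff_congr _ _ _ fun j hj => (ih j (hj.trans_lt hk)).2.1
    have hsy : ∀ n, shiftCoeff (seriesCoeff ρ κ n gy) N = shiftCoeff (seriesCoeff ρ κ n gy') N :=
      fun n => shiftCoeff_congr fun k hk =>
        seriesCoeff_congr _ _ _ fun j hj => (ih j (hj.trans_lt hk)).2.2.1
    -- The unknown `f N` occurs on the right only with the factor `lam 0 = 0`, so the pair `(N, 0)`
    -- alone contributes.
    have hrhs : ∀ n, (∑ p ∈ Finset.HasAntidiagonal.antidiagonal N,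
          lam p.1 * seriesCoeff (fun _ => 1) κ n f p.2) -
        ∑ p ∈ Finset.HasAntidiagonal.antidiagonal N,
          lam' p.1 * seriesCoeff (fun _ => 1) κ n f' p.2 =
        (lam N - lam' N) * seriesCoeff (fun _ => 1) κ n f 0 := by
      intro n
      rw [← Finset.sum_sub_distrib, Finset.sum_eq_single (N, 0)]
      · rcases Nat.eq_zero_or_pos N with rfl | hN
        · simp [hl, hl']
        · simp only [hlow n 0 hN]
          ring
      · intro p hp hne
        have hpN : p.1 + p.2 = N := Finset.HasAntidiagonal.mem_antidiagonal.1 hp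
        have h1 : p.1 < N := by
          by_contra hlt
          exact hne (Prod.ext (by simp only; omega) (by simp only; omega))
        by_cases h2 : p.2 < N
        · rw [(ih _ h1).2.2.2, hlow n _ h2, sub_self]
        · have h3 : p.1 = 0 := by omega
          rw [h3, hl, hl', zero_mul, zero_mul, sub_self]
      · intro hn
        exact absurd (Finset.HasAntidiagonal.mem_antidiagonal.2 (add_zero N)) hn
    have hdiff : ∀ n, Complex.I * (reciprocalNode τ₁ τ₂ n).1 *
          (seriesCoeff ρ κ n gx N - seriesCoeff ρ κ n gx' N) +
        Complex.I * (reciprocalNode τ₁ τ₂ n).2 *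
          (seriesCoeff ρ κ n gy N - seriesCoeff ρ κ n gy' N) =
        (lam N - lam' N) * seriesCoeff (fun _ => 1) κ n f 0 := by
      intro n
      have e := h.equation n N
      rw [hsx, hsy] at e
      rw [← hrhs, ← e, ← h'.equation n N]
      ring
    -- Solvability condition: at `n = 0` the divergence terms vanish, while `f 0 = 1` has integral
    -- `τ₁ τ₂ ≠ 0`.
    have hlam : lam N = lam' N := by
      have e := hdiff 0
      have e0 : reciprocalNode τ₁ τ₂ 0 = 0 := by ext <;> simp [reciprocalNode]
      have e1 : seriesCoeff (fun _ => 1) κ 0 f 0 = ((τ₁ * τ₂ : ℝ) : ℂ) := by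
        have e2 := integral_cell_planeWave h₁ h₂ 0
        rw [if_pos rfl] at e2
        rw [← e2, seriesCoeff, Finset.HasAntidiagonal.antidiagonal_zero, Finset.sum_singleton]
        refine integral_congr_ae ?_
        filter_upwards [hf0] with r hr
        rw [hr, waveCoeff_zero]
        simp
      rw [e0, e1] at e
      simp only [Prod.fst_zero, Prod.snd_zero, Complex.ofReal_zero, mul_zero, zero_mul,
        add_zero] at e
      have e3 : ((τ₁ * τ₂ : ℝ) : ℂ) ≠ 0 := by exact_mod_cast (mul_pos h₁ h₂).ne'
      exact sub_eq_zero.1 ((mul_eq_zero.1 e.symm).resolve_right e3)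
    simp only [Complex.ofReal_one, one_mul] at hfs hxs hys
    have hz := cell_problem_unique h₁ h₂ hρ hP hpos (d := f N - f' N) (gx := gx N - gx' N)
      (gy := gy N - gy' N)
      (fun n => by
        rw [← hfs, ← hxs, h.grad_x, h'.grad_x, hsf]
        ring)
      (fun n => by
        rw [← hfs, ← hys, h.grad_y, h'.grad_y, hsf]
        ring)
      (fun n => by
        have e := hdiff n
        rw [hlam, sub_self, zero_mul, hxρ, hyρ] at e
        refine (mul_eq_zero.1 (?_ : Complex.I * _ = 0)).resolve_left Complex.I_ne_zero
        linear_combination e)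
      (by
        have e := hmean N
        have hi : ∀ g : Lp ℂ 2 (volume.restrict (cell τ₁ τ₂)), Integrable g
            (volume.restrict (cell τ₁ τ₂)) := fun g => (Lp.memLp g).integrable (by norm_num)
        rw [integral_congr_ae (Lp.coeFn_sub (f N) (f' N))]
        simp only [Pi.sub_apply]
        rw [integral_sub (hi _) (hi _), e, sub_self])
    exact ⟨sub_eq_zero.1 hz.1, sub_eq_zero.1 hz.2.1, sub_eq_zero.1 hz.2.2, hlam⟩

/-! ### From the Bloch expansion to the hierarchy -/

/-- A component of the triple `(u, ∂u/∂x, ∂u/∂y)` as a continuous linear map on `H¹`. -/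
def H1.component (Ω : Set Plane) (i : Fin 3) : H1 Ω →L[ℂ] Lp ℂ 2 (volume.restrict Ω) :=
  (PiLp.proj 2 (fun _ : Fin 3 => Lp ℂ 2 (volume.restrict Ω)) i).comp (H1 Ω).subtypeL

theorem H1.component_apply {Ω : Set Plane} (i : Fin 3) (w : H1 Ω) :
    H1.component Ω i w = (w : L2Triple Ω) i := rfl

theorem hasSum_seriesCoeff {τ₁ τ₂ : ℝ} (h₁ : 0 < τ₁) (h₂ : 0 < τ₂) {ρ : Plane → ℝ}
    (hρ : Measurable ρ) {P : ℝ} (hP : ∀ r, |ρ r| ≤ P) (κ : Plane) (n : ℤ × ℤ) {q : ℝ}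
    {f : ℕ → Lp ℂ 2 (volume.restrict (cell τ₁ τ₂))} {F : Lp ℂ 2 (volume.restrict (cell τ₁ τ₂))}
    (hf : Summable fun k : ℕ => ‖(q : ℂ) ^ k • f k‖)
    (hF : HasSum (fun k : ℕ => (q : ℂ) ^ k • f k) F) :
    HasSum (fun N : ℕ => (q : ℂ) ^ N * seriesCoeff ρ κ n f N)
      (∫ r in cell τ₁ τ₂, (ρ r : ℂ) * planeWave (reciprocalNode τ₁ τ₂ n - q • κ) r * F r) := by
  have hM : ∀ r ∈ cell τ₁ τ₂, |κ.1 * r.1 + κ.2 * r.2| ≤ |κ.1| * τ₁ + |κ.2| * τ₂ := by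
    rintro r ⟨hx, hy⟩
    refine (abs_add_le _ _).trans ?_
    rw [abs_mul, abs_mul]
    have hx' : |r.1| ≤ τ₁ := abs_le.2 ⟨by linarith [hx.1], by linarith [hx.2]⟩
    have hy' : |r.2| ≤ τ₂ := abs_le.2 ⟨by linarith [hy.1], by linarith [hy.2]⟩
    gcongr
  exact hasSum_integral_planeWave (measurableSet_cell τ₁ τ₂) hρ hP hM (by positivity) _ hf hF

/-- The coefficients of the expansion of a family of Bloch eigenfunctions satisfy the hierarchy of
cell equations. -/
theorem IsBlochExpansion.isCellHierarchy {τ₁ τ₂ a ε θ q₀ : ℝ} (h₁ : 0 < τ₁) (h₂ : 0 < τ₂)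
    (hε : 0 < ε) {u : ℝ → Plane → ℂ} {nuSq : ℝ → ℂ} {uCoeff : ℕ → H1 (cell τ₁ τ₂)}
    {lamCoeff : ℕ → ℂ} (h : IsBlochExpansion τ₁ τ₂ a ε θ q₀ u nuSq uCoeff lamCoeff) :
    IsCellHierarchy (fun r => (permittivity τ₁ τ₂ a ε r)⁻¹) (Real.cos θ, Real.sin θ)
      (fun k => H1.component _ 0 (uCoeff k)) (fun k => H1.component _ 1 (uCoeff k))
      (fun k => H1.component _ 2 (uCoeff k)) lamCoeff := by
  obtain ⟨κ, hκ⟩ : ∃ κ : Plane, κ = (Real.cos θ, Real.sin θ) := ⟨_, rfl⟩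
  rw [← hκ]
  choose! w hw hws using h.u_series
  have hwc : ∀ i, ∀ q ∈ Ioo 0 q₀, HasSum (fun k : ℕ => (q : ℂ) ^ k • H1.component _ i (uCoeff k))
      (H1.component _ i (w q)) := by
    intro i q hq
    have := (H1.component (cell τ₁ τ₂) i).hasSum (hws q hq)
    simpa only [map_smul] using this
  have hseries : ∀ {ρ : Plane → ℝ} {P : ℝ}, Measurable ρ → (∀ r, |ρ r| ≤ P) → ∀ i n,
      ∀ q ∈ Ioo 0 q₀, HasSum (fun N : ℕ => (q : ℂ) ^ N *
        seriesCoeff ρ κ n (fun k => H1.component _ i (uCoeff k)) N)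
        (∫ r in cell τ₁ τ₂, (ρ r : ℂ) * planeWave (reciprocalNode τ₁ τ₂ n - q • κ) r *
          H1.component _ i (w q) r) := by
    intro ρ P hρ hP i n q hq
    have hs := summable_norm_pow_smul (f := fun k => H1.component _ i (uCoeff k))
      (fun p hp => (hwc i p hp).summable) hq
    exact hasSum_seriesCoeff h₁ h₂ hρ hP κ n hs (hwc i q hq)
  have hρm : Measurable fun r => (permittivity τ₁ τ₂ a ε r)⁻¹ :=
    (measurable_permittivity τ₁ τ₂ a ε).inv
  have hone : ∀ i n, ∀ q ∈ Ioo 0 q₀, HasSum (fun N : ℕ => (q : ℂ) ^ N *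
        seriesCoeff (fun _ => 1) κ n (fun k => H1.component _ i (uCoeff k)) N)
        (∫ r in cell τ₁ τ₂, planeWave (reciprocalNode τ₁ τ₂ n - q • κ) r *
          H1.component _ i (w q) r) := by
    intro i n q hq
    have := hseries (ρ := fun _ => 1) (P := 1) measurable_const (by simp) i n q hq
    simpa only [Complex.ofReal_one, one_mul] using this
  have hper := hseries hρm (abs_inv_permittivity_le hε)
  have heq := fun n q (hq : q ∈ Ioo 0 q₀) => (h.eigenfunction q hq).cell_equations h₁ h₂ hε
    (hw q hq) n (l := reciprocalNode τ₁ τ₂ n - q • κ) (by rw [hκ]; rfl)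
  simp only [← H1.component_apply] at heq
  have hlam : ∀ n, ∀ q ∈ Ioo 0 q₀, HasSum (fun N : ℕ => (q : ℂ) ^ N *
      ∑ p ∈ Finset.HasAntidiagonal.antidiagonal N, lamCoeff p.1 *
        seriesCoeff (fun _ => 1) κ n (fun k => H1.component _ 0 (uCoeff k)) p.2)
      (nuSq q * ∫ r in cell τ₁ τ₂, planeWave (reciprocalNode τ₁ τ₂ n - q • κ) r *
        H1.component _ 0 (w q) r) := by
    intro n q hq
    set c := seriesCoeff (fun _ => 1) κ n (fun k => H1.component _ 0 (uCoeff k)) with hc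
    have hsc : ∀ p ∈ Ioo 0 q₀, HasSum (fun k : ℕ => (p : ℂ) ^ k • c k)
        (∫ r in cell τ₁ τ₂, planeWave (reciprocalNode τ₁ τ₂ n - p • κ) r *
          H1.component _ 0 (w p) r) := fun p hp => by
      simpa only [smul_eq_mul] using hone 0 n p hp
    have hsl : ∀ p ∈ Ioo 0 q₀, Summable fun k : ℕ => (p : ℂ) ^ k • lamCoeff k := fun p hp => by
      simpa only [smul_eq_mul] using (h.nuSq_series p hp).summable
    -- Regarding each `λ_k` as multiplication on `ℂ` makes the product of two scalar series an
    -- instance of the Cauchy product for functionals.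
    have hT : Summable fun k : ℕ =>
        ‖(q : ℂ) ^ k • (lamCoeff k • ContinuousLinearMap.id ℂ ℂ)‖ := by
      refine (summable_norm_pow_smul hsl hq).congr fun k => ?_
      simp [norm_smul]
    have hprod := hasSum_antidiagonal_apply (f := c)
      (T := fun k => lamCoeff k • ContinuousLinearMap.id ℂ ℂ)
      (T' := nuSq q • ContinuousLinearMap.id ℂ ℂ) hT
      (summable_norm_pow_smul (fun p hp => (hsc p hp).summable) hq)
      (fun x => by simpa [mul_assoc] using (h.nuSq_series q hq).mul_right x) (hsc q hq)
    simpa only [smul_apply, ContinuousLinearMap.id_apply, smul_eq_mul] using hprod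
  refine ⟨fun n => coeff_eq_of_hasSum h.pos (hone 1 n) fun q hq => ?_,
    fun n => coeff_eq_of_hasSum h.pos (hone 2 n) fun q hq => ?_,
    fun n => coeff_eq_of_hasSum h.pos (s := fun q => nuSq q * ∫ r in cell τ₁ τ₂,
      planeWave (reciprocalNode τ₁ τ₂ n - q • κ) r * H1.component _ 0 (w q) r)
      (fun q hq => ?_) (hlam n)⟩
  · have e := (heq n q hq).1
    -- In the factor `ξ - qκ` the term `-qκ` multiplies the series by `q`, which is a shift of its
    -- coefficients.
    have hs := ((hone 0 n q hq).mul_left (-Complex.I * (reciprocalNode τ₁ τ₂ n).1)).add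
      ((hasSum_shiftCoeff (hone 0 n q hq)).mul_left (Complex.I * κ.1))
    convert! hs using 1
    · ext k
      ring
    · refine e.trans ?_
      simp only [Prod.fst_sub, Prod.smul_fst, smul_eq_mul]
      push_cast
      ring
  · have e := (heq n q hq).2.1
    have hs := ((hone 0 n q hq).mul_left (-Complex.I * (reciprocalNode τ₁ τ₂ n).2)).add
      ((hasSum_shiftCoeff (hone 0 n q hq)).mul_left (Complex.I * κ.2))
    convert! hs using 1
    · ext k
      ring
    · refine e.trans ?_
      simp only [Prod.snd_sub, Prod.smul_snd, smul_eq_mul]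
      push_cast
      ring
  · have e := (heq n q hq).2.2
    have hs := (((hper 1 n q hq).mul_left (Complex.I * (reciprocalNode τ₁ τ₂ n).1)).sub
      ((hasSum_shiftCoeff (hper 1 n q hq)).mul_left (Complex.I * κ.1))).add
      (((hper 2 n q hq).mul_left (Complex.I * (reciprocalNode τ₁ τ₂ n).2)).sub
      ((hasSum_shiftCoeff (hper 2 n q hq)).mul_left (Complex.I * κ.2)))
    convert! hs using 1
    · ext k
      ring
    · refine e.symm.trans ?_
      simp only [Prod.fst_sub, Prod.smul_fst, Prod.snd_sub, Prod.smul_snd, smul_eq_mul]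
      push_cast
      ring

/-- The normalization forces the higher coefficients to have mean value zero. -/
theorem IsBlochExpansion.integral_uCoeff {τ₁ τ₂ a ε θ q₀ : ℝ} {u : ℝ → Plane → ℂ} {nuSq : ℝ → ℂ}
    {uCoeff : ℕ → H1 (cell τ₁ τ₂)} {lamCoeff : ℕ → ℂ}
    (h : IsBlochExpansion τ₁ τ₂ a ε θ q₀ u nuSq uCoeff lamCoeff) {N : ℕ} (hN : N ≠ 0) :
    ∫ r in cell τ₁ τ₂, H1.component _ 0 (uCoeff N) r = 0 := by
  obtain ⟨T, hT, -⟩ := exists_functional (μ := volume.restrict (cell τ₁ τ₂)) (w := fun _ => 1)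
    aestronglyMeasurable_const zero_le_one (Filter.Eventually.of_forall fun _ => by simp)
  simp only [one_mul] at hT
  rw [← hT, coeff_eq_of_hasSum h.pos (c := fun k => T (H1.component _ 0 (uCoeff k)))
    (d := fun k => if k = 0 then ((τ₁ * τ₂ : ℝ) : ℂ) else 0) (s := fun _ => ((τ₁ * τ₂ : ℝ) : ℂ))
    (fun q hq => ?_) (fun q hq => ?_) N, if_neg hN]
  · obtain ⟨w, hw, hs⟩ := h.u_series q hq
    have h1 := T.hasSum ((H1.component (cell τ₁ τ₂) 0).hasSum hs)
    simp only [map_smul, smul_eq_mul] at h1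
    have h2 : T (H1.component (cell τ₁ τ₂) 0 w) = ((τ₁ * τ₂ : ℝ) : ℂ) := by
      rw [hT, ← h.normalized q hq]
      exact integral_congr_ae hw
    rwa [h2] at h1
  · have h1 := hasSum_ite_eq (0 : ℕ) ((τ₁ * τ₂ : ℝ) : ℂ)
    refine h1.congr_fun fun k => ?_
    split_ifs with hk
    · rw [hk, pow_zero, one_mul]
    · rw [mul_zero]

theorem theorem1 (τ₁ τ₂ a ε θ q₀ : ℝ) (hτ : min τ₁ τ₂ = 1) (ha : 0 < a) (ha' : a < 1 / 2)
    (hε : 0 < ε) (u : ℝ → Plane → ℂ) (nuSq : ℝ → ℂ)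
    (uCoeff : ℕ → H1 (cell τ₁ τ₂)) (lamCoeff : ℕ → ℂ)
    (h : IsBlochExpansion τ₁ τ₂ a ε θ q₀ u nuSq uCoeff lamCoeff) :
    (∀ k : ℕ, Odd k → ∀ᵐ r ∂(volume.restrict (cell τ₁ τ₂)),
      H1.fn (uCoeff k) (-r) = -H1.fn (uCoeff k) r) ∧
    (∀ k : ℕ, Even k → ∀ᵐ r ∂(volume.restrict (cell τ₁ τ₂)),
      H1.fn (uCoeff k) (-r) = H1.fn (uCoeff k) r) ∧
    (∀ k : ℕ, 1 ≤ k → lamCoeff (2 * k - 1) = 0) := by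
  have h₁ : 0 < τ₁ := one_pos.trans_le (hτ ▸ min_le_left _ _)
  have h₂ : 0 < τ₂ := one_pos.trans_le (hτ ▸ min_le_right _ _)
  have hh := h.isCellHierarchy h₁ h₂ hε
  have hrefl : ∀ k, (((1 : ℂ) * (-1) ^ k) • reflect (H1.component _ 0 (uCoeff k)) :
      Lp ℂ 2 (volume.restrict (cell τ₁ τ₂))) =ᵐ[volume.restrict (cell τ₁ τ₂)]
      fun r => (-1) ^ k * H1.component _ 0 (uCoeff k) (-r) := fun k => by
    filter_upwards [Lp.coeFn_smul ((1 : ℂ) * (-1) ^ k) (reflect (H1.component _ 0 (uCoeff k))),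
      coeFn_reflect (H1.component _ 0 (uCoeff k))] with r hr hr'
    rw [hr, Pi.smul_apply, hr', one_mul, smul_eq_mul]
  have huniq := hh.unique h₁ h₂ (measurable_permittivity τ₁ τ₂ a ε).inv
    (abs_inv_permittivity_le hε) (fun r => inv_pos.2 (permittivity_pos hε r))
    (hh.reflect fun r => by rw [permittivity_neg]) h.uCoeff_zero h.lamCoeff_zero
    -- The means agree: at order `0` the sign is `1`, and at higher orders both means are zero.
    (by rw [h.lamCoeff_zero, mul_zero]) (fun N => by
      rw [integral_congr_ae (hrefl N), integral_const_mul,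
        integral_cell_neg τ₁ τ₂ (H1.component _ 0 (uCoeff N))]
      rcases eq_or_ne N 0 with rfl | hN
      · rw [pow_zero, one_mul]
      · rw [h.integral_uCoeff hN, mul_zero])
  have hsym : ∀ k, ∀ᵐ r ∂(volume.restrict (cell τ₁ τ₂)),
      H1.fn (uCoeff k) r = (-1) ^ k * H1.fn (uCoeff k) (-r) := fun k => by
    have h1 := hrefl k
    rw [← (huniq k).1] at h1
    exact h1
  refine ⟨fun k hk => ?_, fun k hk => ?_, fun k hk => ?_⟩
  · filter_upwards [hsym k] with r hr
    rw [hr, hk.neg_one_pow]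
    ring
  · filter_upwards [hsym k] with r hr
    rw [hr, hk.neg_one_pow, one_mul]
  · have h1 := (huniq (2 * k - 1)).2.2.2
    have hodd : Odd (2 * k - 1) := ⟨k - 1, by omega⟩
    rw [hodd.neg_one_pow] at h1
    linear_combination h1 / 2

end
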